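/- Let $m\ge 3$ and $n=m^2$, and consider the $m\times m$ grid with wrap-around (the Cartesian product of two cycles of length $m$), in which each of the $n$ nodes has four neighbours. Let $\lambda_e\ge 0$ and $\lambda>0$. A source generates new versions as a Poisson process $N_s(t)$ of rate $\lambda_e$; it sends its current version to each node as a Poisson process of rate $\lambda/n$; and each node sends the version it holds to each of its four neighbours as a Poisson process of rate $\lambda/4$; all these processes are mutually independent. Let $N_i(t)$ be the version held by node $i$ at time $t$, with $N_s(0)=N_i(0)=0$: when the source sends to $i$, node $i$ takes the source's current version; when $k$ sends to $i$, node $i$ takes the newer of the two versions held by $k$ and $i$. Put $X_i(t)=N_s(t)-N_i(t)$ and, for a nonempty set $S$ of nodes, $X_S(t)=\min_{i\in S}X_i(t)$ and $v_S=\lim_{t\to\infty}\mathbb{E}[X_S(t)]$. Let $N(S)$ be the set of nodes outside $S$ that have a neighbour in $S$. Then $X_S(t)$ is integrable for every $t$ and the limit $v_S$ exists and is finite for every nonempty $S$. Moreover, if $S$ is a nonempty set of nodes that induces a connected subgraph and $|S|=j\le 3n/4$, then $N(S)\neq\emptyset$ and $$v_S \;\le\; \frac{\dfrac{2\lambda_e}{\lambda}+\lfloor\sqrt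 j\rfloor\,\max_{i\in N(S)}v_{S\cup\{i\}}}{\dfrac jn+\lfloor\sqrt j\rfloor}.$$ -/

import Mathlib

open MeasureTheory ProbabilityTheory Filter Topology
open scoped NNReal

noncomputable section

namespace Gossip

/-- A (homogeneous) Poisson process of rate `r`: it starts at `0`, has nondecreasing
right-continuous `ℕ`-valued paths, and has independent increments, the increment over `(s, t]`
being Poisson with mean `r (t - s)`. Rate `0` gives the process that never jumps. -/
structure IsPoissonProcess {Ω : Type*} [MeasurableSpace Ω] (N : ℝ≥0 → Ω → ℕ) (r : ℝ≥0)
    (P : Measure Ω) : Prop where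
  measurable : ∀ t, Measurable (N t)
  start : ∀ᵐ ω ∂P, N 0 ω = 0
  mono : ∀ᵐ ω ∂P, Monotone fun t => N t ω
  rightCont : ∀ᵐ ω ∂P, ∀ t, ContinuousWithinAt (fun u => N u ω) (Set.Ioi t) t
  law : ∀ s t, s ≤ t → HasLaw (fun ω => N t ω - N s ω) (poissonMeasure (r * (t - s))) P
  indep : HasIndepIncrements N P

/-- The rates of a gossip network with node set `ι`: `source` is the rate `λ_e` at which the source
generates new versions, `push i` the rate at which the source sends to node `i`, and `link i j` the
rate `λ_{ij}` at which node `i` sends to node `j`. -/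
structure Network (ι : Type*) where
  source : ℝ≥0
  push : ι → ℝ≥0
  link : ι → ι → ℝ≥0

/-- The clocks of a gossip network: the source generating a version, the source sending its version
to node `i`, and node `i` sending its version to node `j`. -/
inductive Clock (ι : Type*) where
  | source : Clock ι
  | push (i : ι) : Clock ι
  | link (i j : ι) : Clock ι

namespace Network

/-- The rate of each clock. -/
def rate {ι : Type*} (G : Network ι) : Clock ι → ℝ≥0
  | .source => G.source
  | .push i => G.push i
  | .link i j => G.link i j

open Classical in
/-- The neighbouring nodes `N(S)`: the nodes outside `S` that send to some node of `S` at a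
positive rate. -/
def neighbors {ι : Type*} [Fintype ι] (G : Network ι) (S : Finset ι) : Finset ι :=
  {i | i ∉ S ∧ ∃ j ∈ S, 0 < G.link i j}

end Network

/-- `N c t` is the number of rings of clock `c` up to time `t`; the clocks are mutually independent
Poisson processes with the rates of the network. -/
structure IsClockFamily {ι Ω : Type*} [MeasurableSpace Ω] (G : Network ι)
    (N : Clock ι → ℝ≥0 → Ω → ℕ) (P : Measure Ω) : Prop where
  poisson : ∀ c, IsPoissonProcess (N c) (G.rate c) P
  indep : iIndepFun (fun c ω t => N c t ω) P

/-- The versions held by the nodes just after clock `c` rings, when before it the source has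
version `k` and node `i` has version `x i`. -/
def Clock.act {ι : Type*} [DecidableEq ι] : Clock ι → ℕ → (ι → ℕ) → ι → ℕ
  | .source, _, x => x
  | .push i, k, x => Function.update x i k
  | .link i j, _, x => Function.update x j (max (x j) (x i))

/-- Clock `c` rings exactly once during `(s, t]` and no other clock rings. -/
def OnlyRings {ι Ω : Type*} (N : Clock ι → ℝ≥0 → Ω → ℕ) (c : Clock ι) (s t : ℝ≥0) (ω : Ω) : Prop :=
  N c t ω = N c s ω + 1 ∧ ∀ c', c' ≠ c → N c' t ω = N c' s ω

/-- `V t ω i` is the version held by node `i` at time `t`: all versions are `0` at time `0`, they do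
not change while no clock rings, and they change according to `Clock.act` when a clock rings. For
finitely many independent Poisson clocks, almost surely no two clocks ring at the same time, so
every `(0, t]` splits into finitely many intervals with at most one ring each and these rules
determine `V`. -/
structure IsVersionProcess {ι Ω : Type*} [DecidableEq ι] [MeasurableSpace Ω]
    (N : Clock ι → ℝ≥0 → Ω → ℕ) (V : ℝ≥0 → Ω → ι → ℕ) (P : Measure Ω) : Prop where
  start : ∀ᵐ ω ∂P, ∀ i, V 0 ω i = 0
  quiet : ∀ᵐ ω ∂P, ∀ s t, s ≤ t → (∀ c, N c t ω = N c s ω) → V t ω = V s ω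
  ring : ∀ᵐ ω ∂P, ∀ c s t, s ≤ t → OnlyRings N c s t ω →
    V t ω = c.act (N .source s ω) (V s ω)

/-- The version age `X_i(t)` of node `i`. -/
def age {ι Ω : Type*} (N : Clock ι → ℝ≥0 → Ω → ℕ) (V : ℝ≥0 → Ω → ι → ℕ) (i : ι) (t : ℝ≥0)
    (ω : Ω) : ℝ :=
  (N .source t ω : ℝ) - (V t ω i : ℝ)

/-- The version age `X_S(t)` of a nonempty set `S` of nodes. -/
def setAge {ι Ω : Type*} (N : Clock ι → ℝ≥0 → Ω → ℕ) (V : ℝ≥0 → Ω → ι → ℕ) (S : Finset ι)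
    (hS : S.Nonempty) (t : ℝ≥0) (ω : Ω) : ℝ :=
  S.inf' hS fun i => age N V i t ω

/-- The limiting average version age `v_S`. -/
def limAge {ι Ω : Type*} [MeasurableSpace Ω] (P : Measure Ω) (N : Clock ι → ℝ≥0 → Ω → ℕ)
    (V : ℝ≥0 → Ω → ι → ℕ) (S : Finset ι) (hS : S.Nonempty) : ℝ :=
  limUnder atTop fun t : ℝ≥0 => ∫ ω, setAge N V S hS t ω ∂P

/-- The wrap-around `m × m` grid. -/
def torus (m : ℕ) : SimpleGraph (Fin m × Fin m) :=
  (SimpleGraph.cycleGraph m).boxProd (SimpleGraph.cycleGraph m)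

open Classical in
/-- The gossip network on the wrap-around `m × m` grid: the source generates versions at rate
`lamE` and sends to each of the `m ^ 2` nodes at rate `lam / m ^ 2`, and each node sends to each of
its neighbours at rate `lam / 4`. -/
def gridNetwork (m : ℕ) (lamE lam : ℝ≥0) : Network (Fin m × Fin m) where
  source := lamE
  push _ := lam / (m : ℝ≥0) ^ 2
  link i j := if (torus m).Adj i j then lam / 4 else 0

end Gossip

end

/-! Three kinds of ring move $X_S$: a ring of the source adds 1, a push into $S$ resets it to 0, and
a link from $i$ into $S$ replaces it by $X_{S\cup\{i\}}$. So $u_S(t)=\mathbb E X_S(t)$ obeys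
$u_S'=\lambda_e+\sum_{i\notin S}\lambda_i(S)\,u_{S\cup\{i\}}-q_S u_S$, where $q_S>0$ is the total
rate into $S$ (`generator_setAge`). Going down from the full set, every $u_S$ converges, and the
limits satisfy $q_S v_S=\lambda_e+\sum_i\lambda_i(S)v_{S\cup\{i\}}$ (`inRate_mul_limAge`).

The differential equation appears only as a first order expansion with error $O((1+t)h^2)$
(`IsAgeLike.abs_integral_sub_le`), to which a discrete Grönwall argument applies
(`tendsto_of_expansion`). The expansion needs the state at time $t$ to be independent of later rings
(`indepFun_state_increment`): almost surely the state is the eventual value of explicit functions of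
the clock increments over dyadic partitions of $[0,t]$.

On the grid, $q_S=\lambda j/n+\lambda B/4$ with $B$ the number of boundary edges of $S$. With $M$
the maximum of $v_{S\cup\{i\}}$ over $N(S)$, the balance equation gives $\frac jn v_S+\frac
B4(v_S-M)\le\lambda_e/\lambda$. Since $v_S\ge M$ and $B\ge2\sqrt j$ (`two_mul_sqrt_card_le`),
doubling this gives the claim. The isoperimetric bound counts the rows and columns that $S$ meets
without filling. -/

noncomputable section

namespace Gossip

set_option linter.unusedSectionVars false

/-! ### Deterministic evolution of the state along a path -/

section Paths

variable {ι : Type*}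

/-- A clock is the source clock, a push clock or a link clock. -/
def Clock.equivSum : Clock ι ≃ Unit ⊕ ι ⊕ (ι × ι) where
  toFun
    | .source => .inl ()
    | .push i => .inr (.inl i)
    | .link i j => .inr (.inr (i, j))
  invFun
    | .inl _ => .source
    | .inr (.inl i) => .push i
    | .inr (.inr p) => .link p.1 p.2
  left_inv c := by cases c <;> rfl
  right_inv s := by rcases s with _ | _ | _ <;> rfl

instance [Fintype ι] : Fintype (Clock ι) := Fintype.ofEquiv _ Clock.equivSum.symm

instance [DecidableEq ι] : DecidableEq (Clock ι) := Clock.equivSum.decidableEq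

lemma Clock.sum_eq [Fintype ι] {M : Type*} [AddCommMonoid M] (f : Clock ι → M) :
    ∑ c, f c = f .source + (∑ i, f (.push i) + ∑ i, ∑ j, f (.link i j)) := by
  rw [← Clock.equivSum.symm.sum_comp f]
  simp [Fintype.sum_sum_type, Fintype.sum_prod_type, Clock.equivSum]

/-- The number of versions generated by a ring of the clock. -/
def Clock.newVersions : Clock ι → ℕ
  | .source => 1
  | .push _ => 0
  | .link _ _ => 0

/-- The joint state (version of the source, versions of the nodes) after a ring of the clock. -/
def Clock.jump [DecidableEq ι] (c : Clock ι) (z : ℕ × (ι → ℕ)) : ℕ × (ι → ℕ) :=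
  (z.1 + c.newVersions, c.act z.1 z.2)

lemma Clock.newVersions_eq_single [DecidableEq ι] (c : Clock ι) :
    c.newVersions = (Pi.single c 1 : Clock ι → ℕ) .source := by
  cases c <;> simp [Clock.newVersions]

/-- The invariant that no node is ahead of the source; it keeps ages between 0 and the version of
the source. -/
lemma Clock.jump_snd_le [DecidableEq ι] (c : Clock ι) {z : ℕ × (ι → ℕ)} (hz : ∀ i, z.2 i ≤ z.1)
    (i : ι) : (c.jump z).2 i ≤ (c.jump z).1 := by
  have := hz i
  cases c with
  | source => simp only [jump, act, newVersions]; omega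
  | push k =>
    simp only [jump, act, newVersions, Function.update_apply]
    split_ifs <;> omega
  | link k l =>
    have := hz k
    have := hz l
    simp only [jump, act, newVersions, Function.update_apply]
    split_ifs <;> omega

lemma Clock.newVersions_le_one (c : Clock ι) : c.newVersions ≤ 1 := by
  cases c <;> simp [Clock.newVersions]

/-- The counts `d` of rings of the clocks record at most one ring. -/
def Sparse [DecidableEq ι] (d : Clock ι → ℕ) : Prop :=
  d = 0 ∨ ∃ c, d = Pi.single c 1

open Classical in
/-- The joint state after the rings counted by `d`, ignoring deliveries unless exactly one clock
rings. -/
def advance [DecidableEq ι] (d : Clock ι → ℕ) (z : ℕ × (ι → ℕ)) : ℕ × (ι → ℕ) :=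
  -- The witness is unique by `advance_single`, so the choice is harmless. The other branch is
  -- correct for `d = 0`; for several rings it is a default that still keeps every node at or behind
  -- the source.
  if h : ∃ c, d = Pi.single c 1 then h.choose.jump z else (z.1 + d .source, z.2)

lemma advance_single [DecidableEq ι] (c : Clock ι) (z : ℕ × (ι → ℕ)) :
    advance (Pi.single c 1) z = c.jump z := by
  have h : ∃ c', (Pi.single c 1 : Clock ι → ℕ) = Pi.single c' 1 := ⟨c, rfl⟩
  rw [advance, dif_pos h]
  have h2 := congrFun h.choose_spec c
  by_cases hc : c = h.choose
  · rw [← hc]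
  · rw [Pi.single_eq_same, Pi.single_eq_of_ne hc] at h2
    exact absurd h2 one_ne_zero

lemma advance_zero [DecidableEq ι] (z : ℕ × (ι → ℕ)) : advance (0 : Clock ι → ℕ) z = z := by
  have h : ¬ ∃ c, (0 : Clock ι → ℕ) = Pi.single c 1 := by
    rintro ⟨c, hc⟩
    simpa using congrFun hc c
  rw [advance, dif_neg h]
  simp

/-- The joint state after successive increments `d 0, …, d (l - 1)` of the clocks. -/
def chain [DecidableEq ι] (d : ℕ → Clock ι → ℕ) : ℕ → ℕ × (ι → ℕ)
  | 0 => (0, 0)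
  | l + 1 => advance (d l) (chain d l)

lemma chain_congr [DecidableEq ι] {d d' : ℕ → Clock ι → ℕ} {l : ℕ}
    (h : ∀ k < l, d k = d' k) : chain d l = chain d' l := by
  induction l with
  | zero => rfl
  | succ l ih => rw [chain, chain, ih fun k hk => h k (by omega), h l (by omega)]

variable {Ω : Type*}

/-- The number of rings of each clock during `(s, t]`. -/
def increment (N : Clock ι → ℝ≥0 → Ω → ℕ) (s t : ℝ≥0) (ω : Ω) (c : Clock ι) : ℕ :=
  N c t ω - N c s ω

/-- The version of the source together with the versions of the nodes. -/
def state (N : Clock ι → ℝ≥0 → Ω → ℕ) (V : ℝ≥0 → Ω → ι → ℕ) (t : ℝ≥0) (ω : Ω) : ℕ × (ι → ℕ) :=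
  (N .source t ω, V t ω)

/-- The sample point `ω` satisfies the pathwise rules of clocks and version processes. -/
structure IsRegularPoint [DecidableEq ι] (N : Clock ι → ℝ≥0 → Ω → ℕ) (V : ℝ≥0 → Ω → ι → ℕ)
    (ω : Ω) : Prop where
  clock_zero : ∀ c, N c 0 ω = 0
  mono : ∀ c, Monotone fun t => N c t ω
  version_zero : ∀ i, V 0 ω i = 0
  quiet : ∀ s t, s ≤ t → (∀ c, N c t ω = N c s ω) → V t ω = V s ω
  ring : ∀ c s t, s ≤ t → OnlyRings N c s t ω → V t ω = c.act (N .source s ω) (V s ω)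

namespace IsRegularPoint

variable [DecidableEq ι] {N : Clock ι → ℝ≥0 → Ω → ℕ} {V : ℝ≥0 → Ω → ι → ℕ} {ω : Ω}

lemma clock_eq_add (h : IsRegularPoint N V ω) {s t : ℝ≥0} (hst : s ≤ t) (c : Clock ι) :
    N c t ω = N c s ω + increment N s t ω c := by
  have := h.mono c hst
  simp only [increment] at *
  omega

lemma state_of_increment_eq_zero (h : IsRegularPoint N V ω) {s t : ℝ≥0} (hst : s ≤ t)
    (h0 : increment N s t ω = 0) : state N V t ω = state N V s ω := by
  have key : ∀ c, N c t ω = N c s ω := fun c => by simp [h.clock_eq_add hst c, h0]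
  rw [state, state, key, h.quiet s t hst key]

lemma state_of_increment_eq_single (h : IsRegularPoint N V ω) {s t : ℝ≥0} (hst : s ≤ t)
    {c : Clock ι} (hc : increment N s t ω = Pi.single c 1) :
    state N V t ω = c.jump (state N V s ω) := by
  have key : OnlyRings N c s t ω := by
    refine ⟨by simp [h.clock_eq_add hst c, hc], fun c' hc' => ?_⟩
    simp [h.clock_eq_add hst c', hc, Pi.single_eq_of_ne hc']
  simp only [state, Clock.jump, Prod.mk.injEq]
  refine ⟨?_, h.ring c s t hst key⟩
  rw [h.clock_eq_add hst, hc, c.newVersions_eq_single]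

lemma state_zero (h : IsRegularPoint N V ω) : state N V 0 ω = (0, 0) := by
  simp only [state, Prod.mk.injEq]
  exact ⟨h.clock_zero _, funext h.version_zero⟩

/-- If no cell of a partition contains two rings, the order of the rings is known, so the increments
alone determine the state and jump times are not needed. -/
lemma state_eq_chain (h : IsRegularPoint N V ω) {τ : ℕ → ℝ≥0} (hτ : Monotone τ) (h0 : τ 0 = 0)
    {l : ℕ} (hs : ∀ k < l, Sparse (increment N (τ k) (τ (k + 1)) ω)) :
    state N V (τ l) ω = chain (fun k => increment N (τ k) (τ (k + 1)) ω) l := by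
  induction l with
  | zero => rw [h0, h.state_zero, chain]
  | succ l ih =>
    rw [chain, ← ih fun k hk => hs k (by omega)]
    have hl : τ l ≤ τ (l + 1) := hτ (by omega)
    rcases hs l (by omega) with h1 | ⟨c, h1⟩
    · rw [h1, advance_zero, h.state_of_increment_eq_zero hl h1]
    · rw [h1, advance_single, h.state_of_increment_eq_single hl h1]

end IsRegularPoint

lemma advance_snd_le [DecidableEq ι] (d : Clock ι → ℕ) {z : ℕ × (ι → ℕ)}
    (hz : ∀ i, z.2 i ≤ z.1) (i : ι) : (advance d z).2 i ≤ (advance d z).1 := by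
  by_cases h : ∃ c, d = Pi.single c 1
  · rw [advance, dif_pos h]
    exact h.choose.jump_snd_le hz i
  · rw [advance, dif_neg h]
    exact (hz i).trans (Nat.le_add_right _ _)

lemma chain_snd_le [DecidableEq ι] (d : ℕ → Clock ι → ℕ) (l : ℕ) (i : ι) :
    (chain d l).2 i ≤ (chain d l).1 := by
  induction l generalizing i with
  | zero => simp [chain]
  | succ l ih => exact advance_snd_le _ ih i

variable [Fintype ι] [DecidableEq ι] [MeasurableSpace Ω] {G : Network ι}
  {N : Clock ι → ℝ≥0 → Ω → ℕ} {V : ℝ≥0 → Ω → ι → ℕ} {P : Measure Ω}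

lemma ae_isRegularPoint (hN : IsClockFamily G N P) (hV : IsVersionProcess N V P) :
    ∀ᵐ ω ∂P, IsRegularPoint N V ω := by
  have h1 : ∀ᵐ ω ∂P, ∀ c, N c 0 ω = 0 := ae_all_iff.2 fun c => (hN.poisson c).start
  have h2 : ∀ᵐ ω ∂P, ∀ c, Monotone fun t => N c t ω := ae_all_iff.2 fun c => (hN.poisson c).mono
  filter_upwards [h1, h2, hV.start, hV.quiet, hV.ring] with ω a1 a2 a3 a4 a5
  exact ⟨a1, a2, a3, a4, a5⟩

end Paths

/-- Independence passes to limits of eventually constant sequences. -/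
lemma indepFun_of_ae_eventually_eq {Ω α β : Type*} [MeasurableSpace Ω] {P : Measure Ω}
    [IsProbabilityMeasure P] [MeasurableSpace α] [MeasurableSpace β]
    {X : ℕ → Ω → α} {Z : Ω → α} {Y : Ω → β} (hX : ∀ k, Measurable (X k)) (hZ : AEMeasurable Z P)
    (hY : Measurable Y) (hlim : ∀ᵐ ω ∂P, ∀ᶠ k in atTop, X k ω = Z ω)
    (hind : ∀ k, IndepFun (X k) Y P) : IndepFun Z Y P := by
  suffices h : IndepFun (hZ.mk Z) Y P from h.congr hZ.ae_eq_mk.symm (ae_eq_refl _)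
  have hlim' : ∀ᵐ ω ∂P, ∀ᶠ k in atTop, X k ω = hZ.mk Z ω := by
    filter_upwards [hlim, hZ.ae_eq_mk] with ω h1 h2
    rwa [← h2]
  rw [indepFun_iff_measure_inter_preimage_eq_mul]
  intro A B hA hB
  have t1 : Tendsto (fun k => P (X k ⁻¹' A)) atTop (𝓝 (P (hZ.mk Z ⁻¹' A))) := by
    refine tendsto_measure_of_ae_tendsto_indicator_of_isFiniteMeasure atTop
      (hZ.measurable_mk hA) (fun k => hX k hA) ?_
    filter_upwards [hlim'] with ω h
    filter_upwards [h] with k hk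
    simp [hk]
  have t2 : Tendsto (fun k => P (X k ⁻¹' A ∩ Y ⁻¹' B)) atTop
      (𝓝 (P (hZ.mk Z ⁻¹' A ∩ Y ⁻¹' B))) := by
    refine tendsto_measure_of_ae_tendsto_indicator_of_isFiniteMeasure atTop
      ((hZ.measurable_mk hA).inter (hY hB)) (fun k => (hX k hA).inter (hY hB)) ?_
    filter_upwards [hlim'] with ω h
    filter_upwards [h] with k hk
    simp [hk]
  have t3 := ENNReal.Tendsto.mul_const (b := P (Y ⁻¹' B)) t1 (Or.inr (measure_ne_top _ _))
  refine tendsto_nhds_unique t2 (t3.congr fun k => ?_)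
  exact ((hind k).measure_inter_preimage_eq_mul _ _ hA hB).symm

/-! ### Clock increments and independence of the past from later rings -/

section Increments

variable {ι : Type*} [Fintype ι] [DecidableEq ι]

/-- The total rate of the clocks. -/
def Network.totalRate (G : Network ι) : ℝ := ∑ c, (G.rate c : ℝ)

lemma Network.totalRate_nonneg (G : Network ι) : 0 ≤ G.totalRate :=
  Finset.sum_nonneg fun _ _ => NNReal.coe_nonneg _

open Classical in
/-- Split a quantity according to whether no clock, exactly one clock, or more clocks ring. -/
lemma eq_add_sum_add_of_sparse (d : Clock ι → ℕ) (F a : ℝ) (b : Clock ι → ℝ)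
    (h0 : d = 0 → F = a) (h1 : ∀ c, d = Pi.single c 1 → F = b c) :
    F = (if d = 0 then 1 else 0) * a + ∑ c, (if d = Pi.single c 1 then 1 else 0) * b c
      + (if Sparse d then 0 else 1) * F := by
  have hne : ∀ c : Clock ι, (0 : Clock ι → ℕ) ≠ Pi.single c 1 := fun c hc => by
    simpa using congrFun hc c
  by_cases hd : d = 0
  · subst hd
    simp [hne, Sparse, h0 rfl]
  by_cases hs : ∃ c, d = Pi.single c 1
  · obtain ⟨c, rfl⟩ := hs
    have hS : Sparse (Pi.single c 1 : Clock ι → ℕ) := Or.inr ⟨c, rfl⟩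
    have : ∀ c' : Clock ι, (Pi.single c 1 : Clock ι → ℕ) = Pi.single c' 1 ↔ c = c' := by
      refine fun c' => ⟨fun h => ?_, fun h => by rw [h]⟩
      by_contra hc
      have h2 := congrFun h c
      rw [Pi.single_eq_same, Pi.single_eq_of_ne hc] at h2
      exact one_ne_zero h2
    simp [this, hS, h1 c rfl]
  · have hS : ¬ Sparse d := by
      rintro (h | h)
      exacts [hd h, hs h]
    push Not at hs
    simp [hd, hs, hS]

variable {Ω : Type*} [MeasurableSpace Ω] {G : Network ι}
  {N : Clock ι → ℝ≥0 → Ω → ℕ} {V : ℝ≥0 → Ω → ι → ℕ} {P : Measure Ω}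

lemma IsClockFamily.measurable_increment (hN : IsClockFamily G N P) (s t : ℝ≥0) :
    Measurable (increment N s t) :=
  measurable_pi_lambda _ fun c =>
    ((hN.poisson c).measurable t).sub ((hN.poisson c).measurable s)

/-- Independence between clocks combines with independent increments within each clock, giving one
independent family indexed by clock and cell. -/
lemma IsClockFamily.iIndepFun_increment (hN : IsClockFamily G N P) {τ : ℕ → ℝ≥0}
    (hτ : Monotone τ) :
    iIndepFun (fun (p : Clock ι × ℕ) ω => increment N (τ p.2) (τ (p.2 + 1)) ω p.1) P := by
  refine iIndepFun_uncurry' (X := fun c l ω => increment N (τ l) (τ (l + 1)) ω c)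
    (fun c l => (measurable_pi_apply c).comp (hN.measurable_increment _ _)) ?_
    fun c => (hN.poisson c).indep.nat hτ
  refine hN.indep.comp (fun c (x : ℝ≥0 → ℕ) (l : ℕ) => x (τ (l + 1)) - x (τ l)) fun c => ?_
  exact measurable_pi_lambda _ fun l => (measurable_pi_apply _).sub (measurable_pi_apply _)

lemma IsClockFamily.iIndepFun_increment_clock (hN : IsClockFamily G N P) (s t : ℝ≥0) :
    iIndepFun (fun c ω => increment N s t ω c) P := by
  refine hN.indep.comp (fun c (x : ℝ≥0 → ℕ) => x t - x s) fun c => ?_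
  exact (measurable_pi_apply _).sub (measurable_pi_apply _)

lemma IsClockFamily.measureReal_increment_eq (hN : IsClockFamily G N P) (s h : ℝ≥0)
    (d : Clock ι → ℕ) :
    P.real {ω | increment N s (s + h) ω = d} =
      ∏ c, (Real.exp (-(G.rate c * h)) * (G.rate c * h : ℝ) ^ d c / (d c).factorial) := by
  have e : {ω | increment N s (s + h) ω = d} =
      ⋂ c, (fun ω => increment N s (s + h) ω c) ⁻¹' {d c} := by
    ext ω
    simp [funext_iff]
  have h1 := (hN.iIndepFun_increment_clock s (s + h)).measure_inter_preimage_eq_mul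
    Finset.univ (sets := fun c => {d c}) fun c _ => measurableSet_singleton _
  simp only [Finset.mem_univ, Set.iInter_true] at h1
  rw [measureReal_def, e, h1, ENNReal.toReal_prod]
  refine Finset.prod_congr rfl fun c _ => ?_
  have h2 := (hN.poisson c).law s (s + h) le_self_add
  rw [add_tsub_cancel_left] at h2
  have h3 := poissonMeasure_real_singleton (G.rate c * h) (d c)
  rw [← h2.map_eq, measureReal_def,
    Measure.map_apply_of_aemeasurable h2.aemeasurable (measurableSet_singleton _)] at h3
  simpa [increment] using h3

lemma IsClockFamily.measureReal_increment_eq_zero (hN : IsClockFamily G N P) (s h : ℝ≥0) :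
    P.real {ω | increment N s (s + h) ω = 0} = Real.exp (-(G.totalRate * h)) := by
  rw [hN.measureReal_increment_eq]
  simp [Network.totalRate, Finset.sum_mul, ← Real.exp_sum]

lemma IsClockFamily.measureReal_increment_eq_single (hN : IsClockFamily G N P) (s h : ℝ≥0)
    (c : Clock ι) :
    P.real {ω | increment N s (s + h) ω = Pi.single c 1} =
      Real.exp (-(G.totalRate * h)) * (G.rate c * h) := by
  rw [hN.measureReal_increment_eq]
  have h1 : ∀ c', (Real.exp (-(G.rate c' * h)) * (G.rate c' * h : ℝ) ^
      (Pi.single c 1 : Clock ι → ℕ) c' / ((Pi.single c 1 : Clock ι → ℕ) c').factorial) =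
      Real.exp (-(G.rate c' * h)) * (if c' = c then (G.rate c' * h : ℝ) else 1) := by
    intro c'
    by_cases hc : c' = c
    · subst hc
      simp
    · simp [hc]
  rw [Finset.prod_congr rfl fun c' _ => h1 c', Finset.prod_mul_distrib]
  simp [Network.totalRate, Finset.sum_mul, ← Real.exp_sum]

variable [IsProbabilityMeasure P]

lemma measurableSet_sparse : MeasurableSet {d : Clock ι → ℕ | Sparse d} :=
  (Set.to_countable _).measurableSet

lemma integral_ite_one {p : Ω → Prop} [DecidablePred p] (hp : MeasurableSet {ω | p ω}) :
    ∫ ω, (if p ω then (1 : ℝ) else 0) ∂P = P.real {ω | p ω} := by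
  have : (fun ω => if p ω then (1 : ℝ) else 0) = {ω | p ω}.indicator 1 := by
    ext ω
    simp [Set.indicator_apply]
  rw [this, integral_indicator_one hp]

lemma integrable_ite_one {p : Ω → Prop} [DecidablePred p] (hp : MeasurableSet {ω | p ω}) :
    Integrable (fun ω => if p ω then (1 : ℝ) else 0) P := by
  have : (fun ω => if p ω then (1 : ℝ) else 0) = {ω | p ω}.indicator 1 := by
    ext ω
    simp [Set.indicator_apply]
  rw [this]
  exact (integrable_const (1 : ℝ)).indicator hp

/-- The probability that more than one ring occurs is quadratic in the length of the interval. -/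
lemma IsClockFamily.measureReal_not_sparse_le (hN : IsClockFamily G N P) (s h : ℝ≥0) :
    P.real {ω | ¬ Sparse (increment N s (s + h) ω)} ≤ (G.totalRate * h) ^ 2 := by
  classical
  have hm := hN.measurable_increment s (s + h)
  have m0 : ∀ d, MeasurableSet {ω | increment N s (s + h) ω = d} := fun d =>
    hm (measurableSet_singleton d)
  have mS : MeasurableSet {ω | ¬ Sparse (increment N s (s + h) ω)} :=
    (hm measurableSet_sparse).compl
  have key : ∀ ω, (1 : ℝ) = (if increment N s (s + h) ω = 0 then 1 else 0) +
      ∑ c, (if increment N s (s + h) ω = Pi.single c 1 then 1 else 0)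
      + (if ¬ Sparse (increment N s (s + h) ω) then 1 else 0) := fun ω => by
    simpa using eq_add_sum_add_of_sparse (increment N s (s + h) ω) 1 1 1
      (fun _ => rfl) (fun _ _ => rfl)
  have h1 : ∫ _, (1 : ℝ) ∂P = _ := integral_congr_ae (ae_of_all _ key)
  have i1 : Integrable (fun ω =>
      ∑ c, if increment N s (s + h) ω = Pi.single c 1 then (1 : ℝ) else 0) P :=
    integrable_finsetSum _ fun c _ => integrable_ite_one (m0 _)
  have i2 : Integrable (fun ω => (if increment N s (s + h) ω = 0 then (1 : ℝ) else 0) +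
      ∑ c, if increment N s (s + h) ω = Pi.single c 1 then (1 : ℝ) else 0) P :=
    (integrable_ite_one (m0 0)).add i1
  rw [integral_add i2 (integrable_ite_one mS), integral_add (integrable_ite_one (m0 0)) i1,
    integral_finsetSum _ fun c _ => integrable_ite_one (m0 _),
    integral_ite_one mS, integral_ite_one (m0 0)] at h1
  simp only [integral_ite_one (m0 _), hN.measureReal_increment_eq_zero,
    hN.measureReal_increment_eq_single, ← Finset.mul_sum, ← Finset.sum_mul] at h1
  change _ = _ + Real.exp _ * (G.totalRate * h) + _ at h1
  simp only [integral_const, probReal_univ, smul_eq_mul, mul_one] at h1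
  -- With $x=Lh$, $L$ the total rate, the probability is $1-e^{-x}(1+x)\le1-(1-x)(1+x)=x^2$.
  have h2 := Real.add_one_le_exp (-(G.totalRate * h))
  have h3 : 0 ≤ G.totalRate * h := mul_nonneg G.totalRate_nonneg h.2
  nlinarith

/-- The dyadic partition of `[0, t]` into `2 ^ k` intervals, followed by `t + h`. -/
def dyadic (t h : ℝ≥0) (k l : ℕ) : ℝ≥0 :=
  -- The extra point makes $(t,t+h]$ the cell of index `2 ^ k`, so past and future increments belong
  -- to the same independent family.
  if l ≤ 2 ^ k then t * l / 2 ^ k else t + h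

lemma dyadic_zero (t h : ℝ≥0) (k : ℕ) : dyadic t h k 0 = 0 := by simp [dyadic]

lemma dyadic_two_pow (t h : ℝ≥0) (k : ℕ) : dyadic t h k (2 ^ k) = t := by simp [dyadic]

lemma dyadic_two_pow_add_one (t h : ℝ≥0) (k : ℕ) : dyadic t h k (2 ^ k + 1) = t + h := by
  simp [dyadic]

lemma dyadic_succ (t h : ℝ≥0) {k l : ℕ} (hl : l < 2 ^ k) :
    dyadic t h k (l + 1) = dyadic t h k l + t / 2 ^ k := by
  rw [dyadic, dyadic, if_pos (by omega), if_pos (by omega)]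
  push_cast
  rw [mul_add, add_div, mul_one]

lemma dyadic_mono (t h : ℝ≥0) (k : ℕ) : Monotone (dyadic t h k) := by
  refine monotone_nat_of_le_succ fun l => ?_
  rcases lt_trichotomy l (2 ^ k) with hl | rfl | hl
  · rw [dyadic_succ t h hl]
    exact le_self_add
  · rw [dyadic_two_pow, dyadic_two_pow_add_one]
    exact le_self_add
  · rw [dyadic, dyadic, if_neg (by omega), if_neg (by omega)]

/-- Almost surely, the intervals of fine dyadic partitions contain at most one ring each. -/
lemma IsClockFamily.ae_eventually_sparse (hN : IsClockFamily G N P) (t h : ℝ≥0) :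
    ∀ᵐ ω ∂P, ∀ᶠ k in atTop, ∀ l < 2 ^ k,
      Sparse (increment N (dyadic t h k l) (dyadic t h k (l + 1)) ω) := by
  set bad : ℕ → Set Ω := fun k => ⋃ l ∈ Finset.range (2 ^ k),
    {ω | ¬ Sparse (increment N (dyadic t h k l) (dyadic t h k (l + 1)) ω)} with hbad
  -- Union bound over $2^k$ cells, each of probability at most $(Lt/2^k)^2$; the sum over $k$ is
  -- finite and Borel–Cantelli applies.
  have hle : ∀ k, P.real (bad k) ≤ (G.totalRate * t) ^ 2 * (1 / 2) ^ k := by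
    intro k
    refine (measureReal_biUnion_finset_le _ _).trans ?_
    have : ∀ l ∈ Finset.range (2 ^ k),
        P.real {ω | ¬ Sparse (increment N (dyadic t h k l) (dyadic t h k (l + 1)) ω)} ≤
          (G.totalRate * (t / 2 ^ k)) ^ 2 := by
      intro l hl
      rw [dyadic_succ t h (Finset.mem_range.1 hl)]
      simpa using hN.measureReal_not_sparse_le (dyadic t h k l) (t / 2 ^ k)
    refine (Finset.sum_le_sum this).trans (le_of_eq ?_)
    rw [Finset.sum_const, Finset.card_range, nsmul_eq_mul, one_div, inv_pow]
    push_cast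
    field_simp
  have hsum : ∑' k, P (bad k) ≠ ⊤ := by
    have hs : Summable fun k : ℕ => (G.totalRate * t) ^ 2 * (1 / 2 : ℝ) ^ k :=
      summable_geometric_two.mul_left _
    have h1 : ∀ k, P (bad k) ≤ ENNReal.ofReal ((G.totalRate * t) ^ 2 * (1 / 2 : ℝ) ^ k) := by
      intro k
      rw [← ofReal_measureReal (measure_ne_top _ _)]
      exact ENNReal.ofReal_le_ofReal (hle k)
    refine ne_top_of_le_ne_top ?_ (ENNReal.tsum_le_tsum h1)
    rw [← ENNReal.ofReal_tsum_of_nonneg (fun k => by positivity) hs]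
    exact ENNReal.ofReal_ne_top
  filter_upwards [ae_eventually_notMem hsum] with ω hω
  filter_upwards [hω] with k hk l hl
  by_contra hc
  exact hk (Set.mem_biUnion (Finset.mem_coe.2 (Finset.mem_range.2 hl)) hc)

/-- The state at time `t` computed from the increments over the dyadic partition. -/
def dyadicState (N : Clock ι → ℝ≥0 → Ω → ℕ) (t h : ℝ≥0) (k : ℕ) (ω : Ω) : ℕ × (ι → ℕ) :=
  chain (fun l => increment N (dyadic t h k l) (dyadic t h k (l + 1)) ω) (2 ^ k)

lemma ae_eventually_dyadicState_eq (hN : IsClockFamily G N P) (hV : IsVersionProcess N V P)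
    (t h : ℝ≥0) : ∀ᵐ ω ∂P, ∀ᶠ k in atTop, dyadicState N t h k ω = state N V t ω := by
  filter_upwards [hN.ae_eventually_sparse t h, ae_isRegularPoint hN hV] with ω h1 h2
  filter_upwards [h1] with k hk
  have := h2.state_eq_chain (dyadic_mono t h k) (dyadic_zero t h k) hk
  rw [dyadic_two_pow] at this
  exact this.symm

/-- A chain satisfies the bound deterministically, and almost surely the state equals a chain on
some fine dyadic partition. -/
lemma ae_version_le (hN : IsClockFamily G N P) (hV : IsVersionProcess N V P) (t : ℝ≥0) :
    ∀ᵐ ω ∂P, ∀ i, (state N V t ω).2 i ≤ (state N V t ω).1 := by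
  filter_upwards [ae_eventually_dyadicState_eq hN hV t 0] with ω h i
  obtain ⟨k, hk⟩ := h.exists
  rw [← hk]
  exact chain_snd_le _ _ _

/-- The dyadic state uses only cells of index below `2 ^ k`, while the later increment is cell `2 ^
k`: two disjoint blocks of an independent family. Both blocks are finite, so their value spaces are
countable and measurability is automatic. -/
lemma indepFun_dyadicState (hN : IsClockFamily G N P) (t h : ℝ≥0) (k : ℕ) :
    Measurable (dyadicState N t h k) ∧
      IndepFun (dyadicState N t h k) (increment N t (t + h)) P := by
  classical
  set S : Finset (Clock ι × ℕ) := Finset.univ ×ˢ Finset.range (2 ^ k) with hS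
  set T : Finset (Clock ι × ℕ) := Finset.univ ×ˢ {2 ^ k} with hT
  have hST : Disjoint S T := by
    rw [Finset.disjoint_left]
    rintro ⟨c, l⟩ h1 h2
    simp only [hS, hT, Finset.mem_product, Finset.mem_range, Finset.mem_singleton] at h1 h2
    omega
  have hmeas : ∀ p : Clock ι × ℕ, Measurable
      fun ω => increment N (dyadic t h k p.2) (dyadic t h k (p.2 + 1)) ω p.1 := fun p =>
    (measurable_pi_apply p.1).comp (hN.measurable_increment _ _)
  have hind := (hN.iIndepFun_increment (dyadic_mono t h k)).indepFun_finset S T hST hmeas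
  set φ : (S → ℕ) → ℕ × (ι → ℕ) := fun x =>
    chain (fun l c => if hp : (c, l) ∈ S then x ⟨(c, l), hp⟩ else 0) (2 ^ k) with hφ
  set ψ : (T → ℕ) → Clock ι → ℕ := fun x c => x ⟨(c, 2 ^ k), by simp [hT]⟩ with hψ
  have e1 : dyadicState N t h k = φ ∘
      (fun ω (p : S) => increment N (dyadic t h k p.1.2) (dyadic t h k (p.1.2 + 1)) ω p.1.1) := by
    ext1 ω
    refine chain_congr fun l hl => funext fun c => ?_
    rw [dif_pos (by simp [hS, hl])]
  have e2 : increment N t (t + h) = ψ ∘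
      (fun ω (p : T) => increment N (dyadic t h k p.1.2) (dyadic t h k (p.1.2 + 1)) ω p.1.1) := by
    ext ω c
    simp [hψ, dyadic_two_pow, dyadic_two_pow_add_one]
  have mφ : Measurable φ := measurable_of_countable φ
  have mψ : Measurable ψ := measurable_of_countable ψ
  refine ⟨?_, ?_⟩
  · rw [e1]
    exact mφ.comp (measurable_pi_lambda _ fun p => hmeas p.1)
  · rw [e1, e2]
    exact hind.comp mφ mψ

lemma aemeasurable_state (hN : IsClockFamily G N P) (hV : IsVersionProcess N V P) (t : ℝ≥0) :
    AEMeasurable (state N V t) P := by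
  refine aemeasurable_of_tendsto_metrizable_ae atTop
    (fun k => (indepFun_dyadicState hN t 0 k).1.aemeasurable) ?_
  filter_upwards [ae_eventually_dyadicState_eq hN hV t 0] with ω h
  exact tendsto_nhds_of_eventually_eq h

/-- The state at time `t` is independent of the rings after `t`. -/
lemma indepFun_state_increment (hN : IsClockFamily G N P) (hV : IsVersionProcess N V P)
    (t h : ℝ≥0) : IndepFun (state N V t) (increment N t (t + h)) P :=
  indepFun_of_ae_eventually_eq (fun k => (indepFun_dyadicState hN t h k).1)
    (aemeasurable_state hN hV t) (hN.measurable_increment _ _)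
    (ae_eventually_dyadicState_eq hN hV t h) fun k => (indepFun_dyadicState hN t h k).2

end Increments

/-! ### Poisson means and the generator acting on observables of the state -/

lemma hasSum_natCast_poisson (r : ℝ) :
    HasSum (fun n : ℕ => Real.exp (-r) * r ^ n / n.factorial * n) r := by
  have h0 : HasSum (fun n : ℕ => r ^ n / n.factorial) (Real.exp r) := by
    rw [Real.exp_eq_exp_ℝ]
    exact NormedSpace.expSeries_div_hasSum_exp r
  have h1 := h0.mul_left (Real.exp (-r) * r)
  rw [mul_right_comm, ← Real.exp_add, neg_add_cancel, Real.exp_zero, one_mul] at h1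
  rw [← hasSum_nat_add_iff' 1]
  simp only [Finset.sum_range_one, Nat.cast_zero, mul_zero, sub_zero]
  have e : (fun n : ℕ => Real.exp (-r) * r ^ (n + 1) / (n + 1).factorial * (n + 1 : ℕ)) =
      fun n : ℕ => Real.exp (-r) * r * (r ^ n / n.factorial) := by
    ext n
    rw [Nat.factorial_succ]
    push_cast
    field_simp
    ring
  rw [e]
  exact h1

section Generator

variable {ι : Type*} [Fintype ι] [DecidableEq ι] {Ω : Type*} [MeasurableSpace Ω] {G : Network ι}
  {N : Clock ι → ℝ≥0 → Ω → ℕ} {V : ℝ≥0 → Ω → ι → ℕ} {P : Measure Ω} [IsProbabilityMeasure P]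

lemma hasLaw_source (hN : IsClockFamily G N P) (t : ℝ≥0) :
    HasLaw (N .source t) (poissonMeasure (G.source * t)) P := by
  have h := (hN.poisson .source).law 0 t zero_le
  rw [tsub_zero] at h
  refine h.congr ?_
  filter_upwards [(hN.poisson .source).start] with ω hω
  simp [hω]

lemma integrable_natCast_poissonMeasure (r : ℝ≥0) :
    Integrable (fun n : ℕ => (n : ℝ)) (poissonMeasure r) := by
  rw [integrable_poissonMeasure_iff]
  simpa using (hasSum_natCast_poisson r).summable

lemma integral_natCast_poissonMeasure (r : ℝ≥0) :
    ∫ n : ℕ, (n : ℝ) ∂(poissonMeasure r) = r := by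
  rw [integral_poissonMeasure]
  simpa using (hasSum_natCast_poisson r).tsum_eq

lemma integrable_source (hN : IsClockFamily G N P) (t : ℝ≥0) :
    Integrable (fun ω => (N .source t ω : ℝ)) P := by
  have h := hasLaw_source hN t
  have h2 := integrable_natCast_poissonMeasure (G.source * t)
  rw [← h.map_eq] at h2
  exact h2.comp_aemeasurable h.aemeasurable

lemma integral_source (hN : IsClockFamily G N P) (t : ℝ≥0) :
    ∫ ω, (N .source t ω : ℝ) ∂P = G.source * t := by
  have h := hasLaw_source hN t
  have h2 := integral_natCast_poissonMeasure (G.source * t)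
  rw [← h.map_eq, integral_map h.aemeasurable (measurable_of_countable _).aestronglyMeasurable]
    at h2
  simpa using h2

/-- An observable of the state that lies between `0` and the version of the source. -/
def IsAgeLike (f : ℕ × (ι → ℕ) → ℝ) : Prop :=
  ∀ z : ℕ × (ι → ℕ), (∀ i, z.2 i ≤ z.1) → 0 ≤ f z ∧ f z ≤ z.1

lemma isAgeLike_fst : IsAgeLike fun z : ℕ × (ι → ℕ) => (z.1 : ℝ) :=
  fun _ _ => ⟨Nat.cast_nonneg _, le_rfl⟩

lemma IsAgeLike.jump_bounds {f : ℕ × (ι → ℕ) → ℝ} (hf : IsAgeLike f) (c : Clock ι)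
    {z : ℕ × (ι → ℕ)} (hz : ∀ i, z.2 i ≤ z.1) : 0 ≤ f (c.jump z) ∧ f (c.jump z) ≤ z.1 + 1 := by
  obtain ⟨h1, h2⟩ := hf _ (c.jump_snd_le hz)
  refine ⟨h1, h2.trans ?_⟩
  have := c.newVersions_le_one
  simp only [Clock.jump]
  exact_mod_cast by omega

lemma integrable_comp_state (hN : IsClockFamily G N P) (hV : IsVersionProcess N V P) (t : ℝ≥0)
    {g : ℕ × (ι → ℕ) → ℝ}
    (hg : ∀ z : ℕ × (ι → ℕ), (∀ i, z.2 i ≤ z.1) → 0 ≤ g z ∧ g z ≤ z.1 + 1) :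
    Integrable (fun ω => g (state N V t ω)) P := by
  refine ((integrable_source hN t).add (integrable_const (1 : ℝ))).mono'
    ((measurable_of_countable g).comp_aemeasurable
      (aemeasurable_state hN hV t)).aestronglyMeasurable ?_
  filter_upwards [ae_version_le hN hV t] with ω hω
  obtain ⟨h1, h2⟩ := hg _ hω
  rw [Real.norm_of_nonneg h1]
  exact h2

lemma IsAgeLike.integrable {f : ℕ × (ι → ℕ) → ℝ} (hf : IsAgeLike f) (hN : IsClockFamily G N P)
    (hV : IsVersionProcess N V P) (t : ℝ≥0) : Integrable (fun ω => f (state N V t ω)) P :=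
  integrable_comp_state hN hV t fun z hz =>
    ⟨(hf z hz).1, (hf z hz).2.trans (le_add_of_nonneg_right zero_le_one)⟩

lemma IsAgeLike.integrable_jump {f : ℕ × (ι → ℕ) → ℝ} (hf : IsAgeLike f)
    (hN : IsClockFamily G N P) (hV : IsVersionProcess N V P) (c : Clock ι) (t : ℝ≥0) :
    Integrable (fun ω => f (c.jump (state N V t ω))) P :=
  integrable_comp_state (g := fun z => f (c.jump z)) hN hV t fun _ hz => hf.jump_bounds c hz

lemma IsAgeLike.integral_nonneg {f : ℕ × (ι → ℕ) → ℝ} (hf : IsAgeLike f)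
    (hN : IsClockFamily G N P) (hV : IsVersionProcess N V P) (t : ℝ≥0) :
    0 ≤ ∫ ω, f (state N V t ω) ∂P := by
  refine integral_nonneg_of_ae ?_
  filter_upwards [ae_version_le hN hV t] with ω hω using (hf _ hω).1

lemma IsAgeLike.integral_le {f : ℕ × (ι → ℕ) → ℝ} (hf : IsAgeLike f)
    (hN : IsClockFamily G N P) (hV : IsVersionProcess N V P) (t : ℝ≥0) :
    ∫ ω, f (state N V t ω) ∂P ≤ G.source * t := by
  rw [← integral_source hN t]
  refine integral_mono_ae (hf.integrable hN hV t) (integrable_source hN t) ?_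
  filter_upwards [ae_version_le hN hV t] with ω hω using (hf _ hω).2

lemma IsAgeLike.integral_jump_nonneg {f : ℕ × (ι → ℕ) → ℝ} (hf : IsAgeLike f)
    (hN : IsClockFamily G N P) (hV : IsVersionProcess N V P) (c : Clock ι) (t : ℝ≥0) :
    0 ≤ ∫ ω, f (c.jump (state N V t ω)) ∂P := by
  refine integral_nonneg_of_ae ?_
  filter_upwards [ae_version_le hN hV t] with ω hω using (hf.jump_bounds c hω).1

lemma IsAgeLike.integral_jump_le {f : ℕ × (ι → ℕ) → ℝ} (hf : IsAgeLike f)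
    (hN : IsClockFamily G N P) (hV : IsVersionProcess N V P) (c : Clock ι) (t : ℝ≥0) :
    ∫ ω, f (c.jump (state N V t ω)) ∂P ≤ G.source * t + 1 := by
  have h1 : ∫ ω, ((N .source t ω : ℝ) + 1) ∂P = G.source * t + 1 := by
    rw [integral_add (integrable_source hN t) (integrable_const _), integral_source hN t]
    simp
  rw [← h1]
  refine integral_mono_ae (hf.integrable_jump hN hV c t)
    ((integrable_source hN t).add (integrable_const _)) ?_
  filter_upwards [ae_version_le hN hV t] with ω hω using (hf.jump_bounds c hω).2

/-- The Markov property in the form used here: the indicator of what rings after $t$ factors out of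
the expectation. -/
lemma integral_ite_increment_mul (hN : IsClockFamily G N P) (hV : IsVersionProcess N V P)
    (t h : ℝ≥0) (d : Clock ι → ℕ) (g : ℕ × (ι → ℕ) → ℝ) :
    ∫ ω, (if increment N t (t + h) ω = d then 1 else 0) * g (state N V t ω) ∂P =
      P.real {ω | increment N t (t + h) ω = d} * ∫ ω, g (state N V t ω) ∂P := by
  have hm := hN.measurable_increment t (t + h)
  have h1 := ((indepFun_state_increment hN hV t h).symm.comp
    (φ := fun x => if x = d then (1 : ℝ) else 0) (measurable_of_countable _)
    (measurable_of_countable g)).integral_fun_mul_eq_mul_integral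
    ((measurable_of_countable _).comp hm).aestronglyMeasurable
    ((measurable_of_countable g).comp_aemeasurable
      (aemeasurable_state hN hV t)).aestronglyMeasurable
  have h2 := integral_ite_one (P := P) (p := fun ω => increment N t (t + h) ω = d)
    (hm (measurableSet_singleton d))
  simp only [Function.comp_def] at h1
  rw [h1, h2]

lemma integrable_ite_increment_mul (hN : IsClockFamily G N P) (t h : ℝ≥0) (d : Clock ι → ℕ)
    {F : Ω → ℝ} (hF : Integrable F P) :
    Integrable (fun ω => (if increment N t (t + h) ω = d then 1 else 0) * F ω) P := by
  have : (fun ω => (if increment N t (t + h) ω = d then 1 else 0) * F ω) =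
      {ω | increment N t (t + h) ω = d}.indicator F := by
    ext ω
    simp [Set.indicator_apply]
  rw [this]
  exact hF.indicator (hN.measurable_increment t (t + h) (measurableSet_singleton d))

open Classical in
lemma integrable_ite_sparse_mul (hN : IsClockFamily G N P) (t h : ℝ≥0)
    {F : Ω → ℝ} (hF : Integrable F P) :
    Integrable (fun ω => (if Sparse (increment N t (t + h) ω) then 0 else 1) * F ω) P := by
  have : (fun ω => (if Sparse (increment N t (t + h) ω) then 0 else 1) * F ω) =
      {ω | ¬ Sparse (increment N t (t + h) ω)}.indicator F := by
    ext ω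
    by_cases hs : Sparse (increment N t (t + h) ω) <;> simp [hs]
  rw [this]
  exact hF.indicator (hN.measurable_increment t (t + h) measurableSet_sparse).compl

open Classical in
/-- The expectation of an observable, split by the number of rings during a time interval. -/
lemma IsAgeLike.integral_state_add {f : ℕ × (ι → ℕ) → ℝ} (hf : IsAgeLike f)
    (hN : IsClockFamily G N P) (hV : IsVersionProcess N V P) (t h : ℝ≥0) :
    ∫ ω, f (state N V (t + h) ω) ∂P =
      Real.exp (-(G.totalRate * h)) * (∫ ω, f (state N V t ω) ∂P +
        h * ∑ c, G.rate c * ∫ ω, f (c.jump (state N V t ω)) ∂P) +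
      ∫ ω, (if Sparse (increment N t (t + h) ω) then 0 else 1) * f (state N V (t + h) ω) ∂P := by
  have key : ∀ᵐ ω ∂P, f (state N V (t + h) ω) =
      (if increment N t (t + h) ω = 0 then 1 else 0) * f (state N V t ω) +
      ∑ c : Clock ι, (if increment N t (t + h) ω = Pi.single c 1 then 1 else 0) *
        f (c.jump (state N V t ω)) +
      (if Sparse (increment N t (t + h) ω) then 0 else 1) * f (state N V (t + h) ω) := by
    filter_upwards [ae_isRegularPoint hN hV] with ω hω
    refine eq_add_sum_add_of_sparse (increment N t (t + h) ω) _ _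
      (fun c => f (c.jump (state N V t ω))) (fun h0 => ?_) (fun c hc => ?_)
    · rw [hω.state_of_increment_eq_zero le_self_add h0]
    · rw [hω.state_of_increment_eq_single le_self_add hc]
  have i0 := integrable_ite_increment_mul hN t h 0 (hf.integrable hN hV t)
  have i1 : ∀ c : Clock ι, Integrable (fun ω =>
      (if increment N t (t + h) ω = Pi.single c 1 then 1 else 0) *
        f (c.jump (state N V t ω))) P := fun c =>
    integrable_ite_increment_mul hN t h (Pi.single c 1) (hf.integrable_jump hN hV c t)
  have i2 := integrable_finsetSum Finset.univ fun c _ => i1 c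
  have i3 : Integrable (fun ω =>
      (if increment N t (t + h) ω = 0 then 1 else 0) * f (state N V t ω) +
      ∑ c : Clock ι, (if increment N t (t + h) ω = Pi.single c 1 then 1 else 0) *
        f (c.jump (state N V t ω))) P := i0.add i2
  have i4 := integrable_ite_sparse_mul hN t h (hf.integrable hN hV (t + h))
  rw [integral_congr_ae key, integral_add i3 i4, integral_add i0 i2,
    integral_finsetSum _ fun c _ => i1 c, integral_ite_increment_mul hN hV,
    hN.measureReal_increment_eq_zero]
  congr 1
  rw [mul_add, Finset.mul_sum, Finset.mul_sum]
  congr 1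
  refine Finset.sum_congr rfl fun c _ => ?_
  rw [integral_ite_increment_mul hN hV t h _ fun z => f (c.jump z),
    hN.measureReal_increment_eq_single]
  ring

open Classical in
lemma IsAgeLike.integral_not_sparse_nonneg {f : ℕ × (ι → ℕ) → ℝ} (hf : IsAgeLike f)
    (hN : IsClockFamily G N P) (hV : IsVersionProcess N V P) (t h : ℝ≥0) :
    0 ≤ ∫ ω, (if Sparse (increment N t (t + h) ω) then 0 else 1) *
      f (state N V (t + h) ω) ∂P := by
  refine integral_nonneg_of_ae ?_
  filter_upwards [ae_version_le hN hV (t + h)] with ω hω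
  have := (hf _ hω).1
  split_ifs <;> simp [this]

lemma sum_rate_mul_newVersions : ∑ c, (G.rate c : ℝ) * (c.newVersions : ℝ) = G.source := by
  simp [Clock.sum_eq, Clock.newVersions, Network.rate]

-- The observable is unbounded, so a small probability of several rings is not enough. It is
-- dominated by the version of the source, whose mean is known exactly; `integral_state_add` for
-- that observable can then be solved for the remainder.
open Classical in
lemma IsAgeLike.integral_not_sparse_le {f : ℕ × (ι → ℕ) → ℝ} (hf : IsAgeLike f)
    (hN : IsClockFamily G N P) (hV : IsVersionProcess N V P) (t h : ℝ≥0) :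
    ∫ ω, (if Sparse (increment N t (t + h) ω) then 0 else 1) * f (state N V (t + h) ω) ∂P ≤
      (G.source * G.totalRate ^ 2 * t + G.source * G.totalRate) * h ^ 2 := by
  have h1 : ∫ ω, (if Sparse (increment N t (t + h) ω) then 0 else 1) *
        f (state N V (t + h) ω) ∂P ≤
      ∫ ω, (if Sparse (increment N t (t + h) ω) then 0 else 1) *
        ((state N V (t + h) ω).1 : ℝ) ∂P := by
    refine integral_mono_ae (integrable_ite_sparse_mul hN t h (hf.integrable hN hV (t + h)))
      (integrable_ite_sparse_mul hN t h (isAgeLike_fst.integrable hN hV (t + h))) ?_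
    filter_upwards [ae_version_le hN hV (t + h)] with ω hω
    have := (hf _ hω).2
    split_ifs <;> simp [this]
  refine h1.trans ?_
  have h2 := isAgeLike_fst.integral_state_add hN hV t h
  have h3 : ∀ c : Clock ι, ∫ ω, ((c.jump (state N V t ω)).1 : ℝ) ∂P =
      G.source * t + c.newVersions := by
    intro c
    simp only [Clock.jump, state, Nat.cast_add]
    rw [integral_add (integrable_source hN t) (integrable_const _), integral_source hN t]
    simp
  have h4 : ∀ t, ∫ ω, ((state N V t ω).1 : ℝ) ∂P = G.source * t := fun t => integral_source hN t
  simp only [h3, h4, mul_add, Finset.sum_add_distrib, sum_rate_mul_newVersions,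
    ← Finset.sum_mul] at h2
  change _ = _ + (_ * (h * (G.totalRate * _)) + _) + _ at h2
  have e1 := Real.add_one_le_exp (-(G.totalRate * h))
  have e2 := G.totalRate_nonneg
  have p1 : (0 : ℝ) ≤ G.source := G.source.2
  have p2 : (0 : ℝ) ≤ t := t.2
  have p3 : (0 : ℝ) ≤ h := h.2
  push_cast at h2
  have e3 : 0 ≤ (Real.exp (-(G.totalRate * h)) - (1 - G.totalRate * h)) *
      (G.source * t * (1 + G.totalRate * h) + G.source * h) := by
    refine mul_nonneg (by linarith) (by positivity)
  nlinarith

/-- A first order expansion of the expectation of an observable, with the generator of the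
process as its linear term. -/
lemma IsAgeLike.abs_integral_sub_le {f : ℕ × (ι → ℕ) → ℝ} (hf : IsAgeLike f)
    (hN : IsClockFamily G N P) (hV : IsVersionProcess N V P) :
    ∃ C, 0 ≤ C ∧ ∀ t h : ℝ≥0,
      |∫ ω, f (state N V (t + h) ω) ∂P - ∫ ω, f (state N V t ω) ∂P -
        h * ∑ c, G.rate c * (∫ ω, f (c.jump (state N V t ω)) ∂P - ∫ ω, f (state N V t ω) ∂P)| ≤
      C * (1 + t) * h ^ 2 := by
  classical
  have e2 := G.totalRate_nonneg
  have p1 : (0 : ℝ) ≤ G.source := G.source.2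
  refine ⟨3 * G.totalRate ^ 2 * G.source + G.totalRate ^ 2 + G.source * G.totalRate,
    by positivity, fun t h => ?_⟩
  have p2 : (0 : ℝ) ≤ t := t.2
  have p3 : (0 : ℝ) ≤ h := h.2
  have h1 := hf.integral_state_add hN hV t h
  have h2 := hf.integral_not_sparse_nonneg hN hV t h
  have h3 := hf.integral_not_sparse_le hN hV t h
  have h4 := hf.integral_nonneg hN hV t
  have h5 := hf.integral_le hN hV t
  have h6 : 0 ≤ ∑ c, G.rate c * ∫ ω, f (c.jump (state N V t ω)) ∂P :=
    Finset.sum_nonneg fun c _ => mul_nonneg (G.rate c).2 (hf.integral_jump_nonneg hN hV c t)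
  have h7 : ∑ c, G.rate c * ∫ ω, f (c.jump (state N V t ω)) ∂P ≤
      G.totalRate * (G.source * t + 1) := by
    rw [Network.totalRate, Finset.sum_mul]
    exact Finset.sum_le_sum fun c _ =>
      mul_le_mul_of_nonneg_left (hf.integral_jump_le hN hV c t) (G.rate c).2
  simp only [mul_sub (G.rate _ : ℝ), Finset.sum_sub_distrib, ← Finset.sum_mul]
  change |_ - _ - _ * (_ - G.totalRate * _)| ≤ _
  rw [h1]
  generalize ∫ ω, (if Sparse (increment N t (t + h) ω) then 0 else 1) *
    f (state N V (t + h) ω) ∂P = R at h2 h3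
  generalize ∑ c, G.rate c * ∫ ω, f (c.jump (state N V t ω)) ∂P = W at h6 h7
  generalize ∫ ω, f (state N V t ω) ∂P = U at h4 h5
  generalize G.totalRate = L at *
  generalize (G.source : ℝ) = s at *
  generalize (t : ℝ) = t at *
  generalize (h : ℝ) = h at *
  have hx : 0 ≤ L * h := mul_nonneg e2 p3
  have e1 := Real.add_one_le_exp (-(L * h))
  -- With $x=Lh$, multiply $e^{-x}(1+x)\le1$ by $1-x+x^2$ and use $(1+x)(1-x+x^2)=1+x^3\ge1$.
  have e3 : Real.exp (-(L * h)) ≤ 1 - L * h + (L * h) ^ 2 := by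
    have h8 : Real.exp (-(L * h)) * (L * h + 1) ≤ 1 := by
      refine (mul_le_mul_of_nonneg_left (Real.add_one_le_exp (L * h)) (Real.exp_nonneg _)).trans ?_
      rw [← Real.exp_add, neg_add_cancel, Real.exp_zero]
    have h9 : 0 ≤ Real.exp (-(L * h)) * (L * h) ^ 3 := by positivity
    have h10 : 0 ≤ 1 - L * h + (L * h) ^ 2 := by nlinarith [sq_nonneg (L * h - 1)]
    nlinarith [mul_le_mul_of_nonneg_right h8 h10]
  have e4 : Real.exp (-(L * h)) ≤ 1 := Real.exp_le_one_iff.2 (by linarith)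
  generalize Real.exp (-(L * h)) = E at *
  have a1 : 0 ≤ (E - 1 + L * h) * U := mul_nonneg (by linarith) h4
  have a2 : (E - 1 + L * h) * U ≤ (L * h) ^ 2 * (s * t) :=
    mul_le_mul (by linarith) h5 h4 (by positivity)
  have a3 : 0 ≤ (1 - E) * (h * W) := mul_nonneg (by linarith) (by positivity)
  have a4 : (1 - E) * (h * W) ≤ (L * h) * (h * (L * (s * t + 1))) :=
    mul_le_mul (by linarith) (mul_le_mul_of_nonneg_left h7 p3) (by positivity) hx
  -- Each of the three error terms is of order $h^2$: $E-1+Lh$ is quadratic, $1-E$ is linear and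
  -- multiplies $hW$, and $R$ comes from several rings.
  have b1 : E * (U + h * W) + R - U - h * (W - L * U) =
      (E - 1 + L * h) * U - (1 - E) * (h * W) + R := by ring
  rw [b1, abs_le]
  have q1 : 0 ≤ s * L ^ 2 * h ^ 2 := by positivity
  have q2 : 0 ≤ s * L * t * h ^ 2 := by positivity
  have q3 : 0 ≤ s * L ^ 2 * t * h ^ 2 := by positivity
  have q4 : 0 ≤ L ^ 2 * t * h ^ 2 := by positivity
  have q5 : 0 ≤ L ^ 2 * h ^ 2 := by positivity
  have q6 : 0 ≤ s * L * h ^ 2 := by positivity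
  constructor <;> nlinarith

end Generator

/-! ### Convergence from a first order expansion -/

/-- A discrete Grönwall bound for `u' = g - α u` with `g ≤ M` from time `T` on. -/
lemma le_of_expansion {u g : ℝ≥0 → ℝ} {α C M : ℝ} (hα : 0 < α) (hC : 0 ≤ C)
    (h : ∀ t h : ℝ≥0, u (t + h) - u t - h * (g t - α * u t) ≤ C * (1 + t) * h ^ 2)
    {T : ℝ≥0} (hM : ∀ t, T ≤ t → g t ≤ M) (s : ℝ≥0) :
    u (T + s) ≤ M / α + Real.exp (-(α * s)) * |u T - M / α| := by
  set φ : ℝ≥0 → ℝ := fun t => u t - M / α with hφ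
  have step : ∀ t h : ℝ≥0, T ≤ t → φ (t + h) ≤ (1 - α * h) * φ t + C * (1 + t) * h ^ 2 := by
    intro t k ht
    have h1 := h t k
    have h2 := mul_le_mul_of_nonneg_left (hM t ht) k.2
    simp only [NNReal.val_eq_coe] at h2
    have h3 : (1 - α * k) * φ t = u t - M / α - α * k * u t + k * M := by
      simp only [hφ]
      field_simp
      ring
    simp only [hφ] at h3 ⊢
    rw [h3]
    nlinarith
  -- Iterate over $n$ steps of length $k=s/n$. The condition on $n$ makes $1-\alpha k\ge0$, so the
  -- inequalities multiply; $1-\alpha k\le e^{-\alpha k}$ gives the decay, and $n$ errors of order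
  -- $k^2$ total $O(1/n)$.
  have main : ∀ n : ℕ, 0 < n → α * s ≤ n →
      φ (T + s) ≤ Real.exp (-(α * s)) * |φ T| + C * (1 + (T + s)) * s ^ 2 * (1 / n) := by
    intro n hn hns
    have hn' : (0 : ℝ) < n := by exact_mod_cast hn
    set k : ℝ≥0 := s / n with hk
    have hk' : (k : ℝ) = s / n := by simp [hk]
    have hkn : α * k ≤ 1 := by
      rw [hk', ← mul_div_assoc, div_le_one hn']
      exact hns
    have ind : ∀ l : ℕ, l ≤ n → φ (T + l * k) ≤
        Real.exp (-(α * (l * k))) * |φ T| + l * (C * (1 + (T + s)) * k ^ 2) := by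
      intro l
      induction l with
      | zero => intro _; simpa using le_abs_self _
      | succ l ih =>
        intro hl
        have h1 := step (T + l * k) k le_self_add
        have h2 := ih (by omega)
        have e1 : T + (l + 1 : ℕ) * k = T + l * k + k := by push_cast; ring
        have hlk : (l * k : ℝ) ≤ s := by
          rw [hk', ← mul_div_assoc, div_le_iff₀ hn', mul_comm]
          exact mul_le_mul_of_nonneg_left (by exact_mod_cast by omega) s.2
        rw [e1]
        refine h1.trans ?_
        have h3 := mul_le_mul_of_nonneg_left h2 (sub_nonneg.2 hkn)
        have h4 : (1 - α * k) * Real.exp (-(α * (l * k))) ≤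
            Real.exp (-(α * ((l + 1 : ℕ) * k))) := by
          have : -(α * ((l + 1 : ℕ) * k : ℝ)) = -(α * k) + -(α * (l * k)) := by push_cast; ring
          rw [this, Real.exp_add]
          exact mul_le_mul_of_nonneg_right
            (by linarith [Real.add_one_le_exp (-(α * k))]) (Real.exp_nonneg _)
        have h5 := mul_le_mul_of_nonneg_right h4 (abs_nonneg (φ T))
        have h6 : 0 ≤ C * (1 + (T + s)) * (k : ℝ) ^ 2 := by positivity
        have h7 : (1 - α * k) * (l * (C * (1 + (T + s)) * (k : ℝ) ^ 2)) ≤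
            l * (C * (1 + (T + s)) * (k : ℝ) ^ 2) :=
          mul_le_of_le_one_left (by positivity)
            (by linarith [mul_nonneg hα.le k.coe_nonneg])
        have h8 : C * (1 + (T + l * k : ℝ≥0)) * (k : ℝ) ^ 2 ≤
            C * (1 + (T + s)) * (k : ℝ) ^ 2 := by
          push_cast
          gcongr
        have h9 : ((l + 1 : ℕ) : ℝ) * (C * (1 + (T + s)) * (k : ℝ) ^ 2) =
          l * (C * (1 + (T + s)) * (k : ℝ) ^ 2) + C * (1 + (T + s)) * (k : ℝ) ^ 2 := by
          push_cast; ring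
        rw [h9]
        linarith
    have h1 := ind n le_rfl
    have hs : (n * k : ℝ≥0) = s := by
      rw [hk, mul_div_cancel₀]
      exact_mod_cast hn.ne'
    have hs' : (n * k : ℝ) = s := by exact_mod_cast congrArg NNReal.toReal hs
    rw [hs, hs'] at h1
    refine h1.trans (le_of_eq ?_)
    rw [hk']
    field_simp
  have lim : Tendsto (fun n : ℕ => Real.exp (-(α * s)) * |φ T| +
      C * (1 + (T + s)) * (s : ℝ) ^ 2 * (1 / n)) atTop
      (𝓝 (Real.exp (-(α * s)) * |φ T| + C * (1 + (T + s)) * (s : ℝ) ^ 2 * 0)) :=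
    tendsto_const_nhds.add (tendsto_one_div_atTop_nhds_zero_nat.const_mul _)
  rw [mul_zero, add_zero] at lim
  have fin : φ (T + s) ≤ Real.exp (-(α * s)) * |φ T| := by
    refine ge_of_tendsto lim ?_
    filter_upwards [eventually_gt_atTop 0, eventually_ge_atTop ⌈α * s⌉₊] with n h1 h2
    exact main n h1 (Nat.ceil_le.1 h2)
  simp only [hφ] at fin
  linarith

lemma eventually_lt_of_expansion {u g : ℝ≥0 → ℝ} {α C L : ℝ} (hα : 0 < α) (hC : 0 ≤ C)
    (h : ∀ t h : ℝ≥0, u (t + h) - u t - h * (g t - α * u t) ≤ C * (1 + t) * h ^ 2)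
    (hg : Tendsto g atTop (𝓝 L)) {b : ℝ} (hb : L / α < b) : ∀ᶠ t in atTop, u t < b := by
  obtain ⟨M, hM1, hM2⟩ : ∃ M, L < M ∧ M / α < b := by
    obtain ⟨M, h1, h2⟩ := exists_between ((div_lt_iff₀ hα).1 hb)
    exact ⟨M, h1, (div_lt_iff₀ hα).2 h2⟩
  obtain ⟨T, hT⟩ := eventually_atTop.1 (hg.eventually_le_const hM1)
  have h1 := le_of_expansion hα hC h hT
  have lim : Tendsto (fun s : ℝ≥0 => M / α + Real.exp (-(α * s)) * |u T - M / α|) atTop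
      (𝓝 (M / α + 0 * |u T - M / α|)) := by
    refine tendsto_const_nhds.add (Tendsto.mul_const _ ?_)
    refine Real.tendsto_exp_neg_atTop_nhds_zero.comp ?_
    exact (NNReal.tendsto_coe_atTop.2 tendsto_id).const_mul_atTop hα
  rw [zero_mul, add_zero] at lim
  obtain ⟨S, hS⟩ := eventually_atTop.1 (lim.eventually_lt_const hM2)
  filter_upwards [eventually_ge_atTop (T + S)] with t ht
  obtain ⟨r, rfl⟩ := exists_add_of_le ht
  rw [add_assoc]
  exact (h1 _).trans_lt (hS _ le_self_add)

/-- If `u' = g - α u` (in the form of a first order expansion) and `g` converges to `L`, then `u`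
converges to `L / α`. -/
lemma tendsto_of_expansion {u g : ℝ≥0 → ℝ} {α C L : ℝ} (hα : 0 < α) (hC : 0 ≤ C)
    (h : ∀ t h : ℝ≥0, |u (t + h) - u t - h * (g t - α * u t)| ≤ C * (1 + t) * h ^ 2)
    (hg : Tendsto g atTop (𝓝 L)) : Tendsto u atTop (𝓝 (L / α)) := by
  refine tendsto_order.2 ⟨fun a ha => ?_, fun b hb => ?_⟩
  -- The lower bound is the upper bound for `-u` and `-g`.
  · have := eventually_lt_of_expansion (u := -u) (g := -g) (b := -a) hα hC
      (fun t k => by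
        have := (abs_le.1 (h t k)).1
        simp only [Pi.neg_apply]
        linarith) hg.neg (by rw [neg_div]; linarith)
    filter_upwards [this] with t ht
    simpa using ht
  · exact eventually_lt_of_expansion hα hC (fun t k => (abs_le.1 (h t k)).2) hg hb

/-! ### The age of a set: generator, limits and balance equation -/

section SetAge

variable {ι : Type*}

/-- The version age of a set of nodes as a function of the state. -/
def stateAge (S : Finset ι) (hS : S.Nonempty) (z : ℕ × (ι → ℕ)) : ℝ :=
  S.inf' hS fun i => (z.1 : ℝ) - z.2 i

lemma setAge_eq {Ω : Type*} (N : Clock ι → ℝ≥0 → Ω → ℕ) (V : ℝ≥0 → Ω → ι → ℕ) (S : Finset ι)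
    (hS : S.Nonempty) (t : ℝ≥0) (ω : Ω) : setAge N V S hS t ω = stateAge S hS (state N V t ω) :=
  rfl

variable [DecidableEq ι]

lemma isAgeLike_stateAge (S : Finset ι) (hS : S.Nonempty) : IsAgeLike (stateAge S hS) := by
  intro z hz
  refine ⟨Finset.le_inf' _ _ fun i _ => sub_nonneg.2 (by exact_mod_cast hz i), ?_⟩
  obtain ⟨i, hi⟩ := hS
  exact (Finset.inf'_le _ hi).trans (sub_le_self _ (Nat.cast_nonneg _))

lemma stateAge_insert_le (S : Finset ι) (hS : S.Nonempty) (i : ι) (z : ℕ × (ι → ℕ)) :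
    stateAge (insert i S) (Finset.insert_nonempty i S) z ≤ stateAge S hS z :=
  Finset.inf'_mono _ (Finset.subset_insert i S) hS

lemma stateAge_jump_source (S : Finset ι) (hS : S.Nonempty) (z : ℕ × (ι → ℕ)) :
    stateAge S hS (Clock.source.jump z) = stateAge S hS z + 1 := by
  refine le_antisymm ?_ (Finset.le_inf' _ _ fun i hi => ?_)
  · obtain ⟨i, hi, h⟩ := Finset.exists_mem_eq_inf' hS fun i => (z.1 : ℝ) - z.2 i
    rw [stateAge, stateAge, h]
    refine (Finset.inf'_le _ hi).trans (le_of_eq ?_)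
    simp [Clock.jump, Clock.newVersions, Clock.act]
    ring
  · have := Finset.inf'_le (fun i => (z.1 : ℝ) - z.2 i) hi
    simp only [Clock.jump, Clock.newVersions, Clock.act, Nat.cast_add, Nat.cast_one, stateAge]
    linarith

lemma stateAge_jump_push (S : Finset ι) (hS : S.Nonempty) (i : ι) {z : ℕ × (ι → ℕ)}
    (hz : ∀ i, z.2 i ≤ z.1) :
    stateAge S hS ((Clock.push i).jump z) = if i ∈ S then 0 else stateAge S hS z := by
  split_ifs with hi
  · refine le_antisymm ?_ (isAgeLike_stateAge S hS _ (Clock.jump_snd_le _ hz)).1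
    refine (Finset.inf'_le _ hi).trans (le_of_eq ?_)
    simp [Clock.jump, Clock.newVersions, Clock.act]
  · refine Finset.inf'_congr _ rfl fun k hk => ?_
    have : k ≠ i := fun h => hi (h ▸ hk)
    simp [Clock.jump, Clock.newVersions, Clock.act, this]

/-- After the ring, the age of $j$ is the smaller of the ages of $i$ and $j$, so the minimum over
$S$ also takes $i$ into account. -/
lemma stateAge_jump_link (S : Finset ι) (hS : S.Nonempty) (i j : ι) (z : ℕ × (ι → ℕ)) :
    stateAge S hS ((Clock.link i j).jump z) =
      if j ∈ S then stateAge (insert i S) (Finset.insert_nonempty i S) z else stateAge S hS z := by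
  have hval : ∀ k, (((Clock.link i j).jump z).1 : ℝ) - ((Clock.link i j).jump z).2 k =
      (z.1 : ℝ) - (if k = j then max (z.2 j) (z.2 i) else z.2 k : ℕ) := fun k => by
    simp [Clock.jump, Clock.newVersions, Clock.act, Function.update_apply]
  simp only [stateAge, hval]
  split_ifs with hj
  · refine le_antisymm (Finset.le_inf' _ _ fun k hk => ?_) (Finset.le_inf' _ _ fun k hk => ?_)
    · rcases Finset.mem_insert.1 hk with rfl | hk
      · refine (Finset.inf'_le _ hj).trans (sub_le_sub_left (Nat.cast_le.2 ?_) _)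
        rw [if_pos rfl]
        exact le_max_right _ _
      · refine (Finset.inf'_le _ hk).trans (sub_le_sub_left (Nat.cast_le.2 ?_) _)
        split_ifs with hkj
        · rw [hkj]
          exact le_max_left _ _
        · exact le_rfl
    · have h1 := Finset.inf'_le (fun i => (z.1 : ℝ) - z.2 i) (Finset.mem_insert_self i S)
      have h2 := Finset.inf'_le (fun i => (z.1 : ℝ) - z.2 i) (Finset.mem_insert_of_mem (b := i) hk)
      split_ifs with hkj
      · rcases le_total (z.2 j) (z.2 i) with hle | hle
        · rwa [max_eq_right hle]
        · rwa [max_eq_left hle, ← hkj]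
      · exact h2
  · refine Finset.inf'_congr _ rfl fun k hk => ?_
    have : k ≠ j := fun h => hj (h ▸ hk)
    rw [if_neg this]

variable [Fintype ι] {Ω : Type*} [MeasurableSpace Ω] {G : Network ι}
  {N : Clock ι → ℝ≥0 → Ω → ℕ} {V : ℝ≥0 → Ω → ι → ℕ} {P : Measure Ω} [IsProbabilityMeasure P]

/-- The rate `λ_i(S)` at which node `i` sends to the set `S`. -/
def Network.rateInto (G : Network ι) (S : Finset ι) (i : ι) : ℝ := ∑ j ∈ S, (G.link i j : ℝ)

/-- The total rate at which the set `S` receives versions from the source or from other nodes. -/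
def Network.inRate (G : Network ι) (S : Finset ι) : ℝ :=
  ∑ i ∈ S, (G.push i : ℝ) + ∑ i ∈ Sᶜ, G.rateInto S i

lemma integrable_setAge (hN : IsClockFamily G N P) (hV : IsVersionProcess N V P) (S : Finset ι)
    (hS : S.Nonempty) (t : ℝ≥0) : Integrable (setAge N V S hS t) P :=
  (isAgeLike_stateAge S hS).integrable hN hV t

lemma generator_setAge (hN : IsClockFamily G N P) (hV : IsVersionProcess N V P) (S : Finset ι)
    (hS : S.Nonempty) (t : ℝ≥0) :
    ∑ c, G.rate c * (∫ ω, stateAge S hS (c.jump (state N V t ω)) ∂P -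
        ∫ ω, stateAge S hS (state N V t ω) ∂P) =
      (G.source + ∑ i ∈ Sᶜ, G.rateInto S i *
          ∫ ω, setAge N V (insert i S) (Finset.insert_nonempty i S) t ω ∂P) -
        G.inRate S * ∫ ω, setAge N V S hS t ω ∂P := by
  have hage := (isAgeLike_stateAge S hS).integrable hN hV t
  have h1 : ∫ ω, stateAge S hS (Clock.source.jump (state N V t ω)) ∂P =
      ∫ ω, stateAge S hS (state N V t ω) ∂P + 1 := by
    simp only [stateAge_jump_source]
    rw [integral_add hage (integrable_const _)]
    simp
  have h2 : ∀ i, ∫ ω, stateAge S hS ((Clock.push i).jump (state N V t ω)) ∂P =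
      if i ∈ S then 0 else ∫ ω, stateAge S hS (state N V t ω) ∂P := by
    intro i
    have : (fun ω => stateAge S hS ((Clock.push i).jump (state N V t ω))) =ᵐ[P]
        fun ω => if i ∈ S then 0 else stateAge S hS (state N V t ω) := by
      filter_upwards [ae_version_le hN hV t] with ω hω using stateAge_jump_push S hS i hω
    rw [integral_congr_ae this]
    split_ifs <;> simp
  have h3 : ∀ i j, ∫ ω, stateAge S hS ((Clock.link i j).jump (state N V t ω)) ∂P =
      if j ∈ S then ∫ ω, setAge N V (insert i S) (Finset.insert_nonempty i S) t ω ∂P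
        else ∫ ω, stateAge S hS (state N V t ω) ∂P := by
    intro i j
    simp only [stateAge_jump_link, setAge_eq]
    split_ifs <;> rfl
  simp only [Clock.sum_eq, h1, h2, h3, Network.rate]
  simp only [← setAge_eq]
  set u := ∫ ω, setAge N V S hS t ω ∂P with hu
  set w := fun i => ∫ ω, setAge N V (insert i S) (Finset.insert_nonempty i S) t ω ∂P with hw
  have e1 : ∑ i, (G.push i : ℝ) * ((if i ∈ S then 0 else u) - u) = -(∑ i ∈ S, (G.push i : ℝ)) * u := by
    rw [← Finset.sum_neg_distrib, Finset.sum_mul,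
      ← Finset.sum_subset (Finset.subset_univ S) fun i _ hi => by simp [hi]]
    exact Finset.sum_congr rfl fun i hi => by simp [hi]
  have e2 : ∑ i, ∑ j, (G.link i j : ℝ) * ((if j ∈ S then w i else u) - u) =
      ∑ i ∈ Sᶜ, G.rateInto S i * (w i - u) := by
    have : ∀ i, ∑ j, (G.link i j : ℝ) * ((if j ∈ S then w i else u) - u) =
        G.rateInto S i * (w i - u) := by
      intro i
      rw [Network.rateInto, Finset.sum_mul,
        ← Finset.sum_subset (Finset.subset_univ S) fun j _ hj => by simp [hj]]
      exact Finset.sum_congr rfl fun j hj => by simp [hj]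
    simp only [this]
    -- Links within $S$ contribute nothing, since then `insert i S = S`.
    refine (Finset.sum_subset (Finset.subset_univ _) fun i _ hi => ?_).symm
    have hi' : i ∈ S := by simpa using hi
    have : w i = u := by simp only [hw, hu, Finset.insert_eq_of_mem hi']
    simp [this]
  rw [e1, e2, Network.inRate]
  simp only [mul_sub, Finset.sum_sub_distrib, ← Finset.sum_mul]
  ring

/-- Convergence of the mean age of a set, given convergence for its one-point enlargements. -/
lemma tendsto_setAge_of_insert (hN : IsClockFamily G N P) (hV : IsVersionProcess N V P)
    (S : Finset ι) (hS : S.Nonempty) (hpos : 0 < G.inRate S) {v : ι → ℝ}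
    (hv : ∀ i ∈ Sᶜ, Tendsto (fun t : ℝ≥0 =>
      ∫ ω, setAge N V (insert i S) (Finset.insert_nonempty i S) t ω ∂P) atTop (𝓝 (v i))) :
    Tendsto (fun t : ℝ≥0 => ∫ ω, setAge N V S hS t ω ∂P) atTop
      (𝓝 ((G.source + ∑ i ∈ Sᶜ, G.rateInto S i * v i) / G.inRate S)) := by
  obtain ⟨C, hC, h⟩ := (isAgeLike_stateAge S hS).abs_integral_sub_le hN hV
  simp only [generator_setAge hN hV] at h
  refine tendsto_of_expansion hpos hC h ?_
  exact tendsto_const_nhds.add (tendsto_finsetSum _ fun i hi => (hv i hi).const_mul _)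

lemma Network.inRate_pos (hpush : ∀ i, 0 < G.push i) (S : Finset ι) (hS : S.Nonempty) :
    0 < G.inRate S := by
  refine add_pos_of_pos_of_nonneg (Finset.sum_pos (fun i _ => NNReal.coe_pos.2 (hpush i)) hS) ?_
  exact Finset.sum_nonneg fun i _ => Finset.sum_nonneg fun j _ => NNReal.coe_nonneg _

/-- Induction on the size of the complement: the equation for $S$ involves only the larger sets
$S\cup\{i\}$, and the full set has none. Convergence is what gives the `limUnder` in `limAge` its
meaning. -/
lemma tendsto_limAge (hN : IsClockFamily G N P) (hV : IsVersionProcess N V P)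
    (hpush : ∀ i, 0 < G.push i) (S : Finset ι) (hS : S.Nonempty) :
    Tendsto (fun t : ℝ≥0 => ∫ ω, setAge N V S hS t ω ∂P) atTop (𝓝 (limAge P N V S hS)) := by
  suffices h : ∀ (k : ℕ) (S : Finset ι) (hS : S.Nonempty), Sᶜ.card = k →
      ∃ v, Tendsto (fun t : ℝ≥0 => ∫ ω, setAge N V S hS t ω ∂P) atTop (𝓝 v) from
    tendsto_nhds_limUnder (h _ S hS rfl)
  intro k
  induction k with
  | zero =>
    intro S hS hk
    refine ⟨_, tendsto_setAge_of_insert (v := 0) hN hV S hS (G.inRate_pos hpush S hS) ?_⟩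
    intro i hi
    rw [Finset.card_eq_zero.1 hk] at hi
    simp at hi
  | succ k ih =>
    intro S hS hk
    have h : ∀ i, ∃ v, i ∈ Sᶜ → Tendsto (fun t : ℝ≥0 =>
        ∫ ω, setAge N V (insert i S) (Finset.insert_nonempty i S) t ω ∂P) atTop (𝓝 v) := by
      intro i
      by_cases hi : i ∈ Sᶜ
      · obtain ⟨v, hv⟩ := ih (insert i S) (Finset.insert_nonempty i S) (by
          rw [Finset.compl_insert, Finset.card_erase_of_mem hi, hk, Nat.add_sub_cancel])
        exact ⟨v, fun _ => hv⟩
      · exact ⟨0, fun h => absurd h hi⟩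
    choose v hv using h
    exact ⟨_, tendsto_setAge_of_insert hN hV S hS (G.inRate_pos hpush S hS) hv⟩

/-- The balance equation of the limiting mean ages. -/
lemma inRate_mul_limAge (hN : IsClockFamily G N P) (hV : IsVersionProcess N V P)
    (hpush : ∀ i, 0 < G.push i) (S : Finset ι) (hS : S.Nonempty) :
    G.inRate S * limAge P N V S hS = G.source + ∑ i ∈ Sᶜ, G.rateInto S i *
      limAge P N V (insert i S) (Finset.insert_nonempty i S) := by
  have hpos := G.inRate_pos hpush S hS
  have h := tendsto_nhds_unique (tendsto_limAge hN hV hpush S hS)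
    (tendsto_setAge_of_insert hN hV S hS hpos fun i _ => tendsto_limAge hN hV hpush _ _)
  rw [h, mul_div_cancel₀ _ hpos.ne']

lemma limAge_insert_le (hN : IsClockFamily G N P) (hV : IsVersionProcess N V P)
    (hpush : ∀ i, 0 < G.push i) (S : Finset ι) (hS : S.Nonempty) (i : ι) :
    limAge P N V (insert i S) (Finset.insert_nonempty i S) ≤ limAge P N V S hS := by
  refine le_of_tendsto_of_tendsto' (tendsto_limAge hN hV hpush _ (Finset.insert_nonempty i S))
    (tendsto_limAge hN hV hpush S hS) fun t => ?_
  refine integral_mono (integrable_setAge hN hV _ _ t) (integrable_setAge hN hV _ _ t) fun ω => ?_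
  exact stateAge_insert_le S hS i (state N V t ω)

lemma limAge_nonneg (hN : IsClockFamily G N P) (hV : IsVersionProcess N V P)
    (hpush : ∀ i, 0 < G.push i) (S : Finset ι) (hS : S.Nonempty) : 0 ≤ limAge P N V S hS :=
  ge_of_tendsto' (tendsto_limAge hN hV hpush S hS)
    fun t => (isAgeLike_stateAge S hS).integral_nonneg hN hV t

end SetAge

/-! ### Edge isoperimetry on the torus -/

section Isoperimetry

open Fin.CommRing in
/-- A set of residues that is neither empty nor full is left somewhere by the successor map. -/
lemma exists_and_not_add_one {k : ℕ} {p : Fin (k + 3) → Prop} (h1 : ∃ x, p x) (h2 : ∃ x, ¬ p x) :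
    ∃ x, p x ∧ ¬ p (x + 1) := by
  by_contra! h
  obtain ⟨x, hx⟩ := h1
  obtain ⟨y, hy⟩ := h2
  have key : ∀ n : ℕ, p (x + (n : Fin (k + 3))) := by
    intro n
    induction n with
    | zero => simpa using hx
    | succ n ih =>
      have := h _ ih
      rwa [add_assoc, ← Nat.cast_succ] at this
  have := key (y - x).val
  rw [Fin.cast_val_eq_self, add_sub_cancel] at this
  exact hy this

/-- This is where a cycle length of at least 3 matters: an edge leaving $S$ along a cycle and an
edge entering it cannot coincide. -/
lemma add_one_add_one_ne {k : ℕ} (x : Fin (k + 3)) : x + 1 + 1 ≠ x := by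
  intro h
  rw [add_assoc, add_eq_left] at h
  have := congrArg Fin.val h
  have h2 : 2 % (k + 3) = 2 := Nat.mod_eq_of_lt (by omega)
  simp [Fin.val_add, h2] at this

lemma cycleGraph_adj_add_one {k : ℕ} (x : Fin (k + 3)) :
    (SimpleGraph.cycleGraph (k + 3)).Adj (x + 1) x := by
  rw [SimpleGraph.cycleGraph_adj (n := k + 1)]
  simp

open Classical in
/-- The edges of the torus from the complement of `S` to `S`. -/
def edgeBoundary {m : ℕ} (S : Finset (Fin m × Fin m)) :
    Finset ((Fin m × Fin m) × (Fin m × Fin m)) :=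
  (Sᶜ ×ˢ S).filter fun e => (torus m).Adj e.1 e.2

lemma mem_edgeBoundary {m : ℕ} {S : Finset (Fin m × Fin m)} {a b : Fin m × Fin m} :
    (a, b) ∈ edgeBoundary S ↔ a ∉ S ∧ b ∈ S ∧ (torus m).Adj a b := by
  simp [edgeBoundary, and_assoc]

open Classical in
/-- The rows that meet `S` without being contained in it. -/
def mixedRows {m : ℕ} (S : Finset (Fin m × Fin m)) : Finset (Fin m) :=
  {y | (∃ x, (x, y) ∈ S) ∧ ∃ x, (x, y) ∉ S}

open Classical in
/-- The columns that meet `S` without being contained in it. -/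
def mixedCols {m : ℕ} (S : Finset (Fin m × Fin m)) : Finset (Fin m) :=
  {x | (∃ y, (x, y) ∈ S) ∧ ∃ y, (x, y) ∉ S}

lemma mem_mixedRows {m : ℕ} {S : Finset (Fin m × Fin m)} {y : Fin m} :
    y ∈ mixedRows S ↔ (∃ x, (x, y) ∈ S) ∧ ∃ x, (x, y) ∉ S := by
  simp [mixedRows]

lemma mem_mixedCols {m : ℕ} {S : Finset (Fin m × Fin m)} {x : Fin m} :
    x ∈ mixedCols S ↔ (∃ y, (x, y) ∈ S) ∧ ∃ y, (x, y) ∉ S := by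
  simp [mixedCols]

lemma two_mul_card_le_card_of_fibers {α β : Type*} [DecidableEq α] [DecidableEq β]
    (E : Finset α) (R : Finset β) (f : α → β)
    (h : ∀ y ∈ R, ∃ a ∈ E, ∃ b ∈ E, a ≠ b ∧ f a = y ∧ f b = y) : 2 * R.card ≤ E.card := by
  have h1 : (E.filter fun a => f a ∈ R).card = ∑ y ∈ R, (E.filter fun a => f a = y).card := by
    rw [Finset.card_eq_sum_card_fiberwise (s := E.filter fun a => f a ∈ R) (f := f) (t := R)
      fun a ha => (Finset.mem_filter.1 (Finset.mem_coe.1 ha)).2]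
    refine Finset.sum_congr rfl fun y hy => congrArg _ ?_
    ext a
    simp only [Finset.mem_filter]
    constructor
    · rintro ⟨⟨h1, -⟩, h3⟩
      exact ⟨h1, h3⟩
    · rintro ⟨h1, h3⟩
      exact ⟨⟨h1, h3 ▸ hy⟩, h3⟩
  refine le_trans ?_ (h1.symm.le.trans (Finset.card_filter_le _ _))
  rw [mul_comm, ← smul_eq_mul]
  refine Finset.card_nsmul_le_sum _ _ _ fun y hy => ?_
  obtain ⟨a, ha, b, hb, hab, h2, h3⟩ := h y hy
  exact Finset.one_lt_card.2 ⟨a, by simp [ha, h2], b, by simp [hb, h3], hab⟩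

/-- Going once around a mixed row or column, the cycle must leave $S$ and enter it again, which
gives two boundary edges. Edges along rows and edges along columns are disjoint classes. -/
lemma two_mul_card_mixed_le {m : ℕ} (hm : 3 ≤ m) (S : Finset (Fin m × Fin m)) :
    2 * ((mixedRows S).card + (mixedCols S).card) ≤ (edgeBoundary S).card := by
  classical
  obtain ⟨k, rfl⟩ : ∃ k, m = k + 3 := ⟨m - 3, by omega⟩
  have hrow : 2 * (mixedRows S).card ≤ ((edgeBoundary S).filter fun e => e.1.2 = e.2.2).card := by
    refine two_mul_card_le_card_of_fibers _ _ (fun e => e.1.2) fun y hy => ?_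
    obtain ⟨h1, h2⟩ := mem_mixedRows.1 hy
    obtain ⟨x, hx, hx'⟩ := exists_and_not_add_one h1 h2
    obtain ⟨w, hw, hw'⟩ := exists_and_not_add_one (p := fun x => (x, y) ∉ S) h2 (by simpa using h1)
    refine ⟨((x + 1, y), (x, y)), ?_, ((w, y), (w + 1, y)), ?_, ?_, rfl, rfl⟩
    · simp only [Finset.mem_filter, mem_edgeBoundary, and_true]
      exact ⟨hx', hx, Or.inl ⟨cycleGraph_adj_add_one x, rfl⟩⟩
    · simp only [Finset.mem_filter, mem_edgeBoundary, and_true]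
      exact ⟨hw, not_not.1 hw', Or.inl ⟨(cycleGraph_adj_add_one w).symm, rfl⟩⟩
    -- If the two edges agreed as ordered pairs, then $x+1=w$ and $x=w+1$, so $w+1+1=w$.
    · intro h
      simp only [Prod.mk.injEq, and_true] at h
      exact add_one_add_one_ne w (h.2 ▸ h.1)
  have hcol : 2 * (mixedCols S).card ≤ ((edgeBoundary S).filter fun e => ¬ e.1.2 = e.2.2).card := by
    refine two_mul_card_le_card_of_fibers _ _ (fun e => e.1.1) fun y hy => ?_
    obtain ⟨h1, h2⟩ := mem_mixedCols.1 hy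
    obtain ⟨x, hx, hx'⟩ := exists_and_not_add_one h1 h2
    obtain ⟨w, hw, hw'⟩ := exists_and_not_add_one (p := fun x => (y, x) ∉ S) h2 (by simpa using h1)
    refine ⟨((y, x + 1), (y, x)), ?_, ((y, w), (y, w + 1)), ?_, ?_, rfl, rfl⟩
    · simp only [Finset.mem_filter, mem_edgeBoundary]
      exact ⟨⟨hx', hx, Or.inr ⟨cycleGraph_adj_add_one x, rfl⟩⟩, (cycleGraph_adj_add_one x).ne⟩
    · simp only [Finset.mem_filter, mem_edgeBoundary]
      exact ⟨⟨hw, not_not.1 hw', Or.inr ⟨(cycleGraph_adj_add_one w).symm, rfl⟩⟩,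
        (cycleGraph_adj_add_one w).symm.ne⟩
    · intro h
      simp only [Prod.mk.injEq, true_and] at h
      exact add_one_add_one_ne w (h.2 ▸ h.1)
  have := Finset.card_filter_add_card_filter_not (s := edgeBoundary S)
    (fun e => e.1.2 = e.2.2)
  omega

/-- Let $r$ and $c$ count the mixed rows and columns. Without full lines, $S$ lies in a $c\times r$
product, so $|S|\le rc$. With a full row but no full column, every column is mixed and $c=m$;
symmetrically for a full column. With both, no line is empty, so the complement lies in the product
and $m^2/4\le|S^c|\le rc\le(r+c)^2/4$; this case is what the bound $3/4$ is for. -/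
lemma card_le_sq_card_mixed {m : ℕ} (S : Finset (Fin m × Fin m)) (hS : 4 * S.card ≤ 3 * m ^ 2) :
    S.card ≤ ((mixedRows S).card + (mixedCols S).card) ^ 2 := by
  classical
  have hm2 : S.card ≤ m ^ 2 := by omega
  by_cases hr : ∃ y, ∀ x, (x, y) ∈ S
  · obtain ⟨y, hy⟩ := hr
    by_cases hc : ∃ x, ∀ y, (x, y) ∈ S
    · obtain ⟨x, hx⟩ := hc
      have hsub : Sᶜ ⊆ mixedCols S ×ˢ mixedRows S := by
        rintro ⟨a, b⟩ hab
        rw [Finset.mem_compl] at hab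
        exact Finset.mem_product.2 ⟨mem_mixedCols.2 ⟨⟨y, hy a⟩, b, hab⟩,
          mem_mixedRows.2 ⟨⟨x, hx b⟩, a, hab⟩⟩
      have h1 := Finset.card_le_card hsub
      rw [Finset.card_product, Finset.card_compl, Fintype.card_prod, Fintype.card_fin] at h1
      have h2 : m * m = m ^ 2 := by ring
      rw [h2] at h1
      have h3 : m ^ 2 ≤ 4 * ((mixedCols S).card * (mixedRows S).card) := by omega
      have h4 := four_mul_le_pow_two_add (mixedCols S).card (mixedRows S).card
      nlinarith
    · push Not at hc
      have h1 : mixedCols S = Finset.univ :=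
        Finset.eq_univ_iff_forall.2 fun x => mem_mixedCols.2 ⟨⟨y, hy x⟩, hc x⟩
      rw [h1, Finset.card_univ, Fintype.card_fin]
      exact hm2.trans (Nat.pow_le_pow_left (Nat.le_add_left _ _) 2)
  · push Not at hr
    by_cases hc : ∃ x, ∀ y, (x, y) ∈ S
    · obtain ⟨x, hx⟩ := hc
      have h1 : mixedRows S = Finset.univ :=
        Finset.eq_univ_iff_forall.2 fun y => mem_mixedRows.2 ⟨⟨x, hx y⟩, hr y⟩
      rw [h1, Finset.card_univ, Fintype.card_fin]
      exact hm2.trans (Nat.pow_le_pow_left (Nat.le_add_right _ _) 2)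
    · push Not at hc
      have hsub : S ⊆ mixedCols S ×ˢ mixedRows S := by
        rintro ⟨a, b⟩ hab
        exact Finset.mem_product.2 ⟨mem_mixedCols.2 ⟨⟨b, hab⟩, hc a⟩,
          mem_mixedRows.2 ⟨⟨a, hab⟩, hr b⟩⟩
      have h1 := Finset.card_le_card hsub
      rw [Finset.card_product] at h1
      nlinarith

/-- The edge isoperimetric inequality of the torus for sets of at most three quarters of the
nodes. -/
lemma two_mul_sqrt_card_le {m : ℕ} (hm : 3 ≤ m) (S : Finset (Fin m × Fin m))
    (hS : 4 * S.card ≤ 3 * m ^ 2) : 2 * √(S.card : ℝ) ≤ (edgeBoundary S).card := by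
  have h1 : √(S.card : ℝ) ≤ ((mixedRows S).card + (mixedCols S).card : ℕ) :=
    Real.sqrt_le_iff.2 ⟨Nat.cast_nonneg _, by exact_mod_cast card_le_sq_card_mixed S hS⟩
  have h2 : (2 * ((mixedRows S).card + (mixedCols S).card : ℕ) : ℝ) ≤ (edgeBoundary S).card := by
    exact_mod_cast two_mul_card_mixed_le hm S
  linarith

end Isoperimetry

/-! ### Rates of the grid network and the final bound -/

section Grid

variable {m : ℕ} {lamE lam : ℝ≥0}

lemma sum_rateInto_gridNetwork (S : Finset (Fin m × Fin m)) :
    ∑ i ∈ Sᶜ, (gridNetwork m lamE lam).rateInto S i = (edgeBoundary S).card * (lam / 4 : ℝ) := by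
  classical
  have h : ∀ i j, ((gridNetwork m lamE lam).link i j : ℝ) =
      if (torus m).Adj i j then (lam / 4 : ℝ) else 0 := by
    intro i j
    simp only [gridNetwork]
    split_ifs <;> simp
  simp only [Network.rateInto, h]
  rw [← Finset.sum_product' Sᶜ S fun i j => if (torus m).Adj i j then (lam / 4 : ℝ) else 0,
    ← Finset.sum_filter, Finset.sum_const, nsmul_eq_mul]
  rfl

lemma inRate_gridNetwork (S : Finset (Fin m × Fin m)) :
    (gridNetwork m lamE lam).inRate S =
      S.card * (lam / m ^ 2 : ℝ) + (edgeBoundary S).card * (lam / 4 : ℝ) := by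
  rw [Network.inRate, sum_rateInto_gridNetwork]
  simp [gridNetwork]

lemma mem_neighbors_gridNetwork (hlam : 0 < lam) {S : Finset (Fin m × Fin m)} {i : Fin m × Fin m} :
    i ∈ (gridNetwork m lamE lam).neighbors S ↔ i ∉ S ∧ ∃ j ∈ S, (torus m).Adj i j := by
  classical
  have h : ∀ j, 0 < (gridNetwork m lamE lam).link i j ↔ (torus m).Adj i j := by
    intro j
    simp only [gridNetwork]
    split_ifs with h <;> simp [h, hlam]
  simp [Network.neighbors, h]

/-- Lets the sum in the balance equation be bounded by a maximum over the neighbours only. -/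
lemma rateInto_eq_zero (G : Network (Fin m × Fin m)) {S : Finset (Fin m × Fin m)}
    {i : Fin m × Fin m} (hi : i ∉ S) (h : i ∉ G.neighbors S) : G.rateInto S i = 0 := by
  refine Finset.sum_eq_zero fun j hj => ?_
  by_contra h0
  refine h ?_
  simp only [Network.neighbors, Finset.mem_filter, Finset.mem_univ, true_and]
  exact ⟨hi, j, hj, pos_iff_ne_zero.2 fun h1 => h0 (by simp [h1])⟩

end Grid

end Gossip

end

theorem lemma3 (m n : ℕ) (hm : 3 ≤ m) (hn : n = m ^ 2) (lamE lam : ℝ≥0) (hlam : 0 < lam)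
    {Ω : Type*} [MeasurableSpace Ω] (P : Measure Ω) [IsProbabilityMeasure P]
    (N : Gossip.Clock (Fin m × Fin m) → ℝ≥0 → Ω → ℕ)
    (V : ℝ≥0 → Ω → Fin m × Fin m → ℕ)
    (hN : Gossip.IsClockFamily (Gossip.gridNetwork m lamE lam) N P)
    (hV : Gossip.IsVersionProcess N V P) :
    (∀ (T : Finset (Fin m × Fin m)) (hT : T.Nonempty),
      (∀ t, Integrable (Gossip.setAge N V T hT t) P) ∧
      Tendsto (fun t : ℝ≥0 => ∫ ω, Gossip.setAge N V T hT t ω ∂P) atTop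
        (𝓝 (Gossip.limAge P N V T hT))) ∧
    ∀ (S : Finset (Fin m × Fin m)) (hS : S.Nonempty) (j : ℕ),
      ((Gossip.torus m).induce (S : Set (Fin m × Fin m))).Connected →
      S.card = j → (j : ℝ) ≤ 3 * (n : ℝ) / 4 →
      ∃ hne : ((Gossip.gridNetwork m lamE lam).neighbors S).Nonempty,
        Gossip.limAge P N V S hS ≤
          (2 * (lamE : ℝ) / (lam : ℝ) + (⌊√(j : ℝ)⌋ : ℝ) *
              ((Gossip.gridNetwork m lamE lam).neighbors S).sup' hne
                (fun i => Gossip.limAge P N V (insert i S) (Finset.insert_nonempty i S))) /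
            ((j : ℝ) / (n : ℝ) + (⌊√(j : ℝ)⌋ : ℝ)) := by
  have hm0 : (0 : ℝ) < m := by exact_mod_cast (by omega : 0 < m)
  have hlam' : (0 : ℝ) < lam := hlam
  have hpush : ∀ i, 0 < (Gossip.gridNetwork m lamE lam).push i := fun i =>
    div_pos hlam (pow_pos (by exact_mod_cast (by omega : 0 < m)) 2)
  refine ⟨fun T hT => ⟨Gossip.integrable_setAge hN hV T hT,
    Gossip.tendsto_limAge hN hV hpush T hT⟩, ?_⟩
  rintro S hS j - rfl hj
  subst hn
  have hcard : 4 * S.card ≤ 3 * m ^ 2 := by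
    have : (4 * S.card : ℝ) ≤ 3 * m ^ 2 := by push_cast at hj; linarith
    exact_mod_cast this
  have hj1 : (1 : ℝ) ≤ S.card := by exact_mod_cast hS.card_pos
  have hiso := Gossip.two_mul_sqrt_card_le hm S hcard
  have hsqrt : 1 ≤ √(S.card : ℝ) := Real.one_le_sqrt.2 hj1
  -- The isoperimetric bound makes the edge boundary nonempty, and the outer end of a boundary edge
  -- is a neighbour.
  have hne : ((Gossip.gridNetwork m lamE lam).neighbors S).Nonempty := by
    have h1 : (0 : ℝ) < (Gossip.edgeBoundary S).card := by linarith
    obtain ⟨⟨a, b⟩, hab⟩ := Finset.card_pos.1 (by exact_mod_cast h1)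
    obtain ⟨h2, h3, h4⟩ := Gossip.mem_edgeBoundary.1 hab
    exact ⟨a, (Gossip.mem_neighbors_gridNetwork hlam).2 ⟨h2, b, h3, h4⟩⟩
  refine ⟨hne, ?_⟩
  have hbal := Gossip.inRate_mul_limAge hN hV hpush S hS
  set v := Gossip.limAge P N V S hS with hv
  set M := ((Gossip.gridNetwork m lamE lam).neighbors S).sup' hne
    (fun i => Gossip.limAge P N V (insert i S) (Finset.insert_nonempty i S)) with hM
  -- The sign of $v-M$ allows the number of boundary edges to be replaced by its lower bound.
  have hMv : M ≤ v := Finset.sup'_le _ _ fun i _ => Gossip.limAge_insert_le hN hV hpush S hS i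
  have hv0 : 0 ≤ v := Gossip.limAge_nonneg hN hV hpush S hS
  have hsum : ∑ i ∈ Sᶜ, (Gossip.gridNetwork m lamE lam).rateInto S i *
      Gossip.limAge P N V (insert i S) (Finset.insert_nonempty i S) ≤
      ((Gossip.edgeBoundary S).card * (lam / 4 : ℝ)) * M := by
    rw [← Gossip.sum_rateInto_gridNetwork (lamE := lamE), Finset.sum_mul]
    refine Finset.sum_le_sum fun i hi => ?_
    by_cases hi' : i ∈ (Gossip.gridNetwork m lamE lam).neighbors S
    · exact mul_le_mul_of_nonneg_left (Finset.le_sup' (fun i =>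
        Gossip.limAge P N V (insert i S) (Finset.insert_nonempty i S)) hi')
        (Finset.sum_nonneg fun j _ => NNReal.coe_nonneg _)
    · rw [Gossip.rateInto_eq_zero _ (Finset.mem_compl.1 hi) hi', zero_mul, zero_mul]
  rw [Gossip.inRate_gridNetwork] at hbal
  have hsource : ((Gossip.gridNetwork m lamE lam).source : ℝ) = lamE := rfl
  rw [hsource] at hbal
  have hfloor : (⌊√(S.card : ℝ)⌋ : ℝ) ≤ √(S.card : ℝ) := Int.floor_le _
  have hfloor0 : (0 : ℝ) ≤ (⌊√(S.card : ℝ)⌋ : ℝ) := by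
    exact_mod_cast Int.floor_nonneg.2 (Real.sqrt_nonneg _)
  generalize (⌊√(S.card : ℝ)⌋ : ℝ) = f at *
  generalize √(S.card : ℝ) = r at *
  generalize ((Gossip.edgeBoundary S).card : ℝ) = B at *
  push_cast
  have hb : 0 < (S.card : ℝ) / m ^ 2 := by positivity
  rw [le_div_iff₀ (by linarith)]
  have e1 : (S.card : ℝ) * (lam / m ^ 2) = lam * (S.card / m ^ 2) := by ring
  rw [e1] at hbal
  generalize (S.card : ℝ) / m ^ 2 = b at *
  -- The balance equation divided by $\lambda$, with $b=j/n$. Doubling it, replacing $B$ by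
  -- $2f\le2\sqrt j\le B$ and dropping one of the two terms $bv\ge0$ yields the bound.
  have h1 : b * v + B / 4 * (v - M) ≤ lamE / lam := by
    rw [le_div_iff₀ hlam']
    nlinarith
  have h2 : 2 * (lamE : ℝ) / lam = 2 * (lamE / lam) := by ring
  rw [h2]
  have h3 : 2 * f * (v - M) ≤ B * (v - M) :=
    mul_le_mul_of_nonneg_right (by linarith) (by linarith)
  have h4 : 0 ≤ b * v := mul_nonneg hb.le hv0
  nlinarith
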